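/- **Setting.** Let $m\ge 2$ and let $P(\lambda)=\sum_{j=0}^m\lambda^jA_j$ with $A_j\in\mathbb C^{n\times n}$, $A_m\ne 0$. Let $G(\lambda)=P(\lambda)+C(\lambda E-A)^{-1}B$ with $A,E\in\mathbb C^{r\times r}$, $E$ nonsingular, $C\in\mathbb C^{n\times r}$, $B\in\mathbb C^{r\times n}$, and let $\mathcal S(\lambda)=\begin{bmatrix}P(\lambda)&C\\B&A-\lambda E\end{bmatrix}$ be its system matrix. A system matrix of this form is called *irreducible* if the realization $P(\lambda)+C(\lambda E-A)^{-1}B$ of its transfer function is minimal, i.e. $r$ is the smallest size of a pencil $\lambda E'-A'$ among all realizations $P'(\lambda)+C'(\lambda E'-A')^{-1}B'$ ($P'$ a matrix polynomial, $E'$ nonsingular) of the same rational matrix. Assume that $\mathcal S(\lambda)$ is irreducible. **Elementary matrices.** For $X\in\mathbb C^{n\times n}$ put $M_0(X)=\mathrm{diag}(I_{(m-1)n},X)$, $M_{-m}(X)=\mathrm{diag}(X,I_{(m-1)n})$ and, for $1\le i\le m-1$, $$M_i(X)=\mathrm{diag}\Big(I_{(m-i-1)n},\begin{bmatrix}X&I_n\\I_n&0\end{bmatrix},I_{(i-1)n}\Big),\qquad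 M_{-i}(X)=\mathrm{diag}\Big(I_{(m-i-1)n},\begin{bmatrix}0&I_n\\I_n&X\end{bmatrix},I_{(i-1)n}\Big).$$ Put $M_i^P=M_i(-A_i)$ for $0\le i\le m-1$ and $M_{-i}^P=M_{-i}(A_i)$ for $1\le i\le m$. For index tuples $t=(t_1,\dots,t_s)$ and matrices $X=(X_1,\dots,X_s)$ put $M_t(X)=M_{t_1}(X_1)\cdots M_{t_s}(X_s)$ and $M^P_t=M^P_{t_1}\cdots M^P_{t_s}$ (identity if $t=\emptyset$). The matrix assignment $X$ for $t$ is *nonsingular* if the $X_j$ with $t_j\in\{\pm0,\pm m\}$ are nonsingular. **Index tuples.** A tuple $\alpha$ of integers satisfies the *Successor Infix Property* (SIP) if between any two equal entries $k$ of $\alpha$ there is an entry $k+1$. For a tuple $\alpha$ containing $0$, $c_0(\alpha)$ (resp. $i_0(\alpha)$) is the largest $p$ such that $(0,1,\dots,p)$ (resp. $(p,\dots,1,0)$) is a subtuple (not necessarily contiguous) of $\alpha$. **EGFP of $P$.** Let $(\sigma,\omega)$ be a permutation of $\{0,\dots,m\}$ and $\tau=-\omega$. Let $\sigma_1,\sigma_2$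 be tuples of indices from $\sigma\setminus\{m-1,m\}$ such that $(\sigma_1,\sigma,\sigma_2)$ satisfies the SIP, and $\tau_1,\tau_2$ tuples of indices from $\tau\setminus\{-1,-0\}$ such that $(\tau_1,\tau,\tau_2)$ satisfies the SIP. Let $X_1,X_2,Y_1,Y_2$ be nonsingular matrix assignments for $\sigma_1,\sigma_2,\tau_1,\tau_2$. Assume $0\in\sigma$ and $-m\in\tau$, and put $$L(\lambda)=M_{\tau_1}(Y_1)\,M_{\sigma_1}(X_1)\,(\lambda M^P_\tau-M^P_\sigma)\,M_{\sigma_2}(X_2)\,M_{\tau_2}(Y_2).$$ **Theorem.** Let $e_k$ be the $k$-th column of $I_m$. The pencil $$\mathbb L(\lambda)=\begin{bmatrix}L(\lambda)&e_{m-i_0(\sigma_1,\sigma)}\otimes C\\ e^T_{m-c_0(\sigma,\sigma_2)}\otimes B&A-\lambda E\end{bmatrix}$$ is a Rosenbrock strong linearization of $G(\lambda)$. That is: $\mathbb L(\lambda)$ is an irreducible system matrix of the form $\begin{bmatrix}\mathcal X-\lambda\mathcal Y&\mathcal C\\\mathcal B&H-\lambda K\end{bmatrix}$ with $H,K\in\mathbb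 C^{r\times r}$ and $K$ nonsingular, and (a) there are unimodular $mn\times mn$ matrix polynomials $U(\lambda),V(\lambda)$ (determinant a nonzero constant) and nonsingular $U_0,V_0\in\mathbb C^{r\times r}$ with $$\mathrm{diag}(U(\lambda),U_0)\;\mathbb L(\lambda)\;\mathrm{diag}(V(\lambda),V_0)=\mathrm{diag}(I_{(m-1)n},\mathcal S(\lambda));$$ (b) there are biproper $mn\times mn$ rational matrices $\mathcal O_\ell(\lambda),\mathcal O_r(\lambda)$ (i.e. each tends to a nonsingular matrix as $\lambda\to\infty$) with $$\mathcal O_\ell(\lambda)\,\lambda^{-1}\mathbb G(\lambda)\,\mathcal O_r(\lambda)=\mathrm{diag}(I_{(m-1)n},\lambda^{-m}G(\lambda)),$$ where $\mathbb G(\lambda)=\mathcal X-\lambda\mathcal Y+\mathcal C(\lambda K-H)^{-1}\mathcal B$ is the transfer function of $\mathbb L(\lambda)$. -/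

import Mathlib

namespace EGFP

noncomputable section

/-! ### System matrices, transfer functions, irreducibility -/

/-- The constant matrix `M`, seen as a matrix polynomial. -/
def constPoly {α β : Type} (M : Matrix α β ℂ) : Matrix α β (Polynomial ℂ) :=
  M.map Polynomial.C

/-- The pencil `M - λ N`. -/
def pencil {α β : Type} (M N : Matrix α β ℂ) : Matrix α β (Polynomial ℂ) :=
  constPoly M - (Polynomial.X : Polynomial ℂ) • constPoly N

/-- A matrix polynomial, seen as a rational matrix. -/
def toRat {α β : Type} (M : Matrix α β (Polynomial ℂ)) : Matrix α β (RatFunc ℂ) :=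
  M.map (algebraMap (Polynomial ℂ) (RatFunc ℂ))

/-- The system matrix `[P(λ), C; B, A - λ E]`. -/
def systemMatrix {ν : Type} {r : ℕ} (P : Matrix ν ν (Polynomial ℂ))
    (C : Matrix ν (Fin r) ℂ) (B : Matrix (Fin r) ν ℂ) (A E : Matrix (Fin r) (Fin r) ℂ) :
    Matrix (ν ⊕ Fin r) (ν ⊕ Fin r) (Polynomial ℂ) :=
  Matrix.fromBlocks P (constPoly C) (constPoly B) (pencil A E)

/-- The transfer function `P(λ) + C (λ E - A)⁻¹ B` of `[P(λ), C; B, A - λ E]`.  It is used only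
for nonsingular `E`, and then `λ E - A` is invertible over `ℂ(λ)`. -/
def transferFunction {ν : Type} {r : ℕ} (P : Matrix ν ν (Polynomial ℂ))
    (C : Matrix ν (Fin r) ℂ) (B : Matrix (Fin r) ν ℂ) (A E : Matrix (Fin r) (Fin r) ℂ) :
    Matrix ν ν (RatFunc ℂ) :=
  toRat P + toRat (constPoly C) * (-toRat (pencil A E))⁻¹ * toRat (constPoly B)

/-- The system matrix `[P(λ), C; B, A - λ E]` (with `E` nonsingular) is irreducible: the realization
`P(λ) + C (λ E - A)⁻¹ B` is minimal, that is, the size `r` of `λ E - A` is the smallest among all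
realizations of the same rational matrix. -/
def IsIrreducibleSystem {ν : Type} {r : ℕ} (P : Matrix ν ν (Polynomial ℂ))
    (C : Matrix ν (Fin r) ℂ) (B : Matrix (Fin r) ν ℂ) (A E : Matrix (Fin r) (Fin r) ℂ) : Prop :=
  IsUnit E.det ∧
    ∀ (r' : ℕ) (P' : Matrix ν ν (Polynomial ℂ)) (C' : Matrix ν (Fin r') ℂ)
      (B' : Matrix (Fin r') ν ℂ) (A' E' : Matrix (Fin r') (Fin r') ℂ),
      IsUnit E'.det → transferFunction P' C' B' A' E' = transferFunction P C B A E → r ≤ r'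

/-- A matrix polynomial whose determinant is a nonzero constant. -/
def IsUnimodular {ν : Type} [Fintype ν] [DecidableEq ν] (U : Matrix ν ν (Polynomial ℂ)) : Prop :=
  ∃ c : ℂ, c ≠ 0 ∧ U.det = Polynomial.C c

/-- A rational matrix `F` with `F(λ) → D` as `λ → ∞` for a nonsingular matrix `D`. -/
def IsBiproper {ν : Type} [Fintype ν] [DecidableEq ν] (F : Matrix ν ν (RatFunc ℂ)) : Prop :=
  ∃ D : Matrix ν ν ℂ, IsUnit D.det ∧ ∀ i j,
    Filter.Tendsto (fun z : ℂ => (F i j).eval (RingHom.id ℂ) z)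
      (Filter.cocompact ℂ) (nhds (D i j))

/-! ### Block matrices.  The rows of an `mn`-row matrix are indexed by `Fin m × Fin n`
(block number, position in the block).  Block numbers in the comments are `1, …, m`. -/

/-- `e_k ⊗ M`, where `e_k` is the `k`-th column of `I_m` (and `e_k = 0` for `k ∉ {1, …, m}`). -/
def blockCol {n r : ℕ} (m : ℕ) (k : ℤ) (M : Matrix (Fin n) (Fin r) ℂ) :
    Matrix (Fin m × Fin n) (Fin r) ℂ :=
  Matrix.of fun p j => if ((p.1 : ℕ) : ℤ) + 1 = k then M p.2 j else 0

/-- `e_kᵀ ⊗ M`. -/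
def blockRow {n r : ℕ} (m : ℕ) (k : ℤ) (M : Matrix (Fin r) (Fin n) ℂ) :
    Matrix (Fin r) (Fin m × Fin n) ℂ :=
  Matrix.of fun i q => if ((q.1 : ℕ) : ℤ) + 1 = k then M i q.2 else 0

/-- The block diagonal matrix `diag(I_{(m-1)n}, Q)`. -/
def diagLast {n : ℕ} {R : Type} [Zero R] [One R] (m : ℕ) (Q : Matrix (Fin n) (Fin n) R) :
    Matrix (Fin m × Fin n) (Fin m × Fin n) R :=
  Matrix.of fun p q =>
    if (p.1 : ℕ) + 1 = m ∧ (q.1 : ℕ) + 1 = m then Q p.2 q.2 else if p = q then 1 else 0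

/-- `𝕃(λ)` is a Rosenbrock strong linearization of `G(λ) = P(λ) + C (λ E - A)⁻¹ B`, where the
system matrix of `G` is `S(λ) = [P(λ), C; B, A - λ E]`.  In the third clause, the right-hand side
`[diag(I, P), e_m ⊗ C; e_mᵀ ⊗ B, A - λ E]` is `diag(I_{(m-1)n}, S(λ))`. -/
def IsRosenbrockStrongLinearization {n r : ℕ} (m : ℕ)
    (L : Matrix ((Fin m × Fin n) ⊕ Fin r) ((Fin m × Fin n) ⊕ Fin r) (Polynomial ℂ))
    (P : Matrix (Fin n) (Fin n) (Polynomial ℂ))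
    (C : Matrix (Fin n) (Fin r) ℂ) (B : Matrix (Fin r) (Fin n) ℂ)
    (A E : Matrix (Fin r) (Fin r) ℂ) : Prop :=
  ∃ (𝒳 𝒴 : Matrix (Fin m × Fin n) (Fin m × Fin n) ℂ) (𝒞 : Matrix (Fin m × Fin n) (Fin r) ℂ)
    (ℬ : Matrix (Fin r) (Fin m × Fin n) ℂ) (H K : Matrix (Fin r) (Fin r) ℂ),
    L = systemMatrix (pencil 𝒳 𝒴) 𝒞 ℬ H K ∧
    IsIrreducibleSystem (pencil 𝒳 𝒴) 𝒞 ℬ H K ∧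
    (∃ (U V : Matrix (Fin m × Fin n) (Fin m × Fin n) (Polynomial ℂ))
        (U₀ V₀ : Matrix (Fin r) (Fin r) ℂ),
      IsUnimodular U ∧ IsUnimodular V ∧ IsUnit U₀.det ∧ IsUnit V₀.det ∧
      Matrix.fromBlocks U 0 0 (constPoly U₀) * L * Matrix.fromBlocks V 0 0 (constPoly V₀) =
        systemMatrix (diagLast m P) (blockCol m m C) (blockRow m m B) A E) ∧
    (∃ Oₗ Oᵣ : Matrix (Fin m × Fin n) (Fin m × Fin n) (RatFunc ℂ),
      IsBiproper Oₗ ∧ IsBiproper Oᵣ ∧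
      Oₗ * ((RatFunc.X : RatFunc ℂ)⁻¹ • transferFunction (pencil 𝒳 𝒴) 𝒞 ℬ H K) * Oᵣ =
        diagLast m (((RatFunc.X : RatFunc ℂ) ^ m)⁻¹ • transferFunction P C B A E))

/-! ### Index tuples.  A tuple `τ` of indices from `-{0 : m}` is stored as the list `ω` of naturals
with `τ = -ω`, so that `0` and `-0` stay apart. -/

/-- The Successor Infix Property of a tuple of integers: between any two equal entries there is
an entry larger by one.  (This is invariant under translation of the tuple, so the same condition
serves for tuples of nonnegative and of nonpositive indices.) -/
def SIP (α : List ℤ) : Prop :=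
  ∀ (a b : ℕ) (hb : b < α.length) (hab : a < b), α[a]'(hab.trans hb) = α[b] →
    ∃ (c : ℕ) (_ : a < c) (hc : c < b), α[c]'(hc.trans hb) = α[a]'(hab.trans hb) + 1

/-- The number of consecutions of `α` at `t`: the largest `p` such that `(t, t+1, …, t+p)` is a
subtuple of `α`, and `-1` if `t ∉ α`. -/
def consecutions (t : ℕ) (α : List ℕ) : ℤ :=
  if t ∈ α then
    (Nat.findGreatest (fun p => (List.range' t (p + 1)).Sublist α) α.length : ℕ) else -1

/-- The number of inversions of `α` at `t`: the largest `q` such that `(t+q, …, t+1, t)` is a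
subtuple of `α`, and `-1` if `t ∉ α`. -/
def inversions (t : ℕ) (α : List ℕ) : ℤ :=
  if t ∈ α then
    (Nat.findGreatest (fun q => (List.range' t (q + 1)).reverse.Sublist α) α.length : ℕ) else -1

/-! ### Elementary matrices -/

/-- `M_i(X)`, `0 ≤ i ≤ m - 1`: the identity, except that the blocks in block rows and columns
`m - i` and `m - i + 1` are `[X, I; I, 0]`.  For `i = 0` only block `m` is left of these, and
`M_0(X) = diag(I, X)`. -/
def elemPos {n : ℕ} (m i : ℕ) (X : Matrix (Fin n) (Fin n) ℂ) :
    Matrix (Fin m × Fin n) (Fin m × Fin n) ℂ :=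
  Matrix.of fun p q =>
    (if p.1 + 1 + i = m ∧ q.1 + 1 + i = m then X
    else if p.1 + 1 + i = m ∧ q.1 + i = m then 1
    else if p.1 + i = m ∧ q.1 + 1 + i = m then 1
    else if p.1 + i = m ∧ q.1 + i = m then 0
    else if p.1 = q.1 then 1 else 0 : Matrix (Fin n) (Fin n) ℂ) p.2 q.2

/-- `M_{-i}(X)`, `1 ≤ i ≤ m`: the identity, except that the blocks in block rows and columns
`m - i` and `m - i + 1` are `[0, I; I, X]`.  For `i = m` only block `1` is left of these, and
`M_{-m}(X) = diag(X, I)`. -/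
def elemNeg {n : ℕ} (m i : ℕ) (X : Matrix (Fin n) (Fin n) ℂ) :
    Matrix (Fin m × Fin n) (Fin m × Fin n) ℂ :=
  Matrix.of fun p q =>
    (if p.1 + 1 + i = m ∧ q.1 + 1 + i = m then 0
    else if p.1 + 1 + i = m ∧ q.1 + i = m then 1
    else if p.1 + i = m ∧ q.1 + 1 + i = m then 1
    else if p.1 + i = m ∧ q.1 + i = m then X
    else if p.1 = q.1 then 1 else 0 : Matrix (Fin n) (Fin n) ℂ) p.2 q.2

/-- `M_t(X) = M_{t_1}(X_1) ⋯ M_{t_s}(X_s)` for a tuple `t` of indices from `{0 : m-1}`. -/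
def prodPos {n : ℕ} (m : ℕ) (t : List ℕ) (X : List (Matrix (Fin n) (Fin n) ℂ)) :
    Matrix (Fin m × Fin n) (Fin m × Fin n) ℂ :=
  (List.zipWith (elemPos m) t X).prod

/-- `M_{-t}(X) = M_{-t_1}(X_1) ⋯ M_{-t_s}(X_s)` for a tuple `t` of indices from `{1 : m}`. -/
def prodNeg {n : ℕ} (m : ℕ) (t : List ℕ) (X : List (Matrix (Fin n) (Fin n) ℂ)) :
    Matrix (Fin m × Fin n) (Fin m × Fin n) ℂ :=
  (List.zipWith (elemNeg m) t X).prod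

/-- The list `X` is a matrix assignment for the tuple `t` (or `-t`), and it is nonsingular: the
matrices assigned to the positions of the indices `±0` and `±m` are nonsingular. -/
def IsNonsingularAssignment {n : ℕ} (m : ℕ) (t : List ℕ)
    (X : List (Matrix (Fin n) (Fin n) ℂ)) : Prop :=
  X.length = t.length ∧ ∀ p ∈ t.zip X, p.1 = 0 ∨ p.1 = m → IsUnit p.2.det

/-- The matrix polynomial `P(λ) = ∑_{j=0}^m λ^j A_j`. -/
def matPoly {n : ℕ} (m : ℕ) (A : ℕ → Matrix (Fin n) (Fin n) ℂ) :
    Matrix (Fin n) (Fin n) (Polynomial ℂ) :=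
  ∑ j ∈ Finset.range (m + 1), (Polynomial.X : Polynomial ℂ) ^ j • constPoly (A j)

/-- The Fiedler matrix `M^P_i = M_i(-A_i)` for `0 ≤ i ≤ m - 1`, and `M^P_m = (M^P_{-m})⁻¹`. -/
def fiedlerPos {n : ℕ} (m : ℕ) (A : ℕ → Matrix (Fin n) (Fin n) ℂ) (i : ℕ) :
    Matrix (Fin m × Fin n) (Fin m × Fin n) ℂ :=
  if i = m then (elemNeg m m (A m))⁻¹ else elemPos m i (-A i)

/-- The Fiedler matrix `M^P_{-i} = M_{-i}(A_i)` for `1 ≤ i ≤ m`, and `M^P_{-0} = (M^P_0)⁻¹`. -/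
def fiedlerNeg {n : ℕ} (m : ℕ) (A : ℕ → Matrix (Fin n) (Fin n) ℂ) (i : ℕ) :
    Matrix (Fin m × Fin n) (Fin m × Fin n) ℂ :=
  if i = 0 then (elemPos m 0 (-A 0))⁻¹ else elemNeg m i (A i)

/-! ### Extended generalized Fiedler pencils -/

/-- The parameters of an extended generalized Fiedler pencil; `τ = -ω`, `τ₁ = -ω₁`, `τ₂ = -ω₂`. -/
structure Data (m n : ℕ) where
  σ : List ℕ
  ω : List ℕ
  σ₁ : List ℕ
  σ₂ : List ℕ
  ω₁ : List ℕ
  ω₂ : List ℕ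
  X₁ : List (Matrix (Fin n) (Fin n) ℂ)
  X₂ : List (Matrix (Fin n) (Fin n) ℂ)
  Y₁ : List (Matrix (Fin n) (Fin n) ℂ)
  Y₂ : List (Matrix (Fin n) (Fin n) ℂ)
  /-- `(σ, ω)` is a permutation of `{0 : m}`. -/
  perm : (σ ++ ω).Perm (List.range (m + 1))
  /-- The indices of `σ₁`, `σ₂` are from `σ ∖ {m-1, m}`. -/
  mem_σ : ∀ i ∈ σ₁ ++ σ₂, i ∈ σ ∧ i + 1 ≠ m ∧ i ≠ m
  /-- The indices of `τ₁`, `τ₂` are from `τ ∖ {-1, -0}`. -/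
  mem_τ : ∀ i ∈ ω₁ ++ ω₂, i ∈ ω ∧ i ≠ 1 ∧ i ≠ 0
  sip_σ : SIP ((σ₁ ++ σ ++ σ₂).map fun i => (i : ℤ))
  sip_τ : SIP ((ω₁ ++ ω ++ ω₂).map fun i => -(i : ℤ))
  nonsing_X₁ : IsNonsingularAssignment m σ₁ X₁
  nonsing_X₂ : IsNonsingularAssignment m σ₂ X₂
  nonsing_Y₁ : IsNonsingularAssignment m ω₁ Y₁
  nonsing_Y₂ : IsNonsingularAssignment m ω₂ Y₂

/-- The extended generalized Fiedler pencil
`L(λ) = M_{τ₁}(Y₁) M_{σ₁}(X₁) (λ M^P_τ - M^P_σ) M_{σ₂}(X₂) M_{τ₂}(Y₂)` of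
`P(λ) = ∑_{j=0}^m λ^j A_j`. -/
def Data.egfp {m n : ℕ} (D : Data m n) (A : ℕ → Matrix (Fin n) (Fin n) ℂ) :
    Matrix (Fin m × Fin n) (Fin m × Fin n) (Polynomial ℂ) :=
  constPoly (prodNeg m D.ω₁ D.Y₁) * constPoly (prodPos m D.σ₁ D.X₁) *
    ((Polynomial.X : Polynomial ℂ) • constPoly ((D.ω.map (fiedlerNeg m A)).prod) -
      constPoly ((D.σ.map (fiedlerPos m A)).prod)) *
    constPoly (prodPos m D.σ₂ D.X₂) * constPoly (prodNeg m D.ω₂ D.Y₂)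

/-- The bordered pencil
`[L(λ), e_{m-i₀(σ₁,σ)} ⊗ C; e_{m-c₀(σ,σ₂)}ᵀ ⊗ B, A - λ E]`, an extended generalized Fiedler pencil
of `G(λ) = P(λ) + C (λ E - A)⁻¹ B` when `0 ∈ σ` and `-m ∈ τ`.  The coefficients of `P(λ)` are
`coef j`. -/
def Data.egfpG {m n r : ℕ} (D : Data m n) (coef : ℕ → Matrix (Fin n) (Fin n) ℂ)
    (C : Matrix (Fin n) (Fin r) ℂ) (B : Matrix (Fin r) (Fin n) ℂ)
    (A E : Matrix (Fin r) (Fin r) ℂ) :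
    Matrix ((Fin m × Fin n) ⊕ Fin r) ((Fin m × Fin n) ⊕ Fin r) (Polynomial ℂ) :=
  systemMatrix (D.egfp coef)
    (blockCol m ((m : ℤ) - inversions 0 (D.σ₁ ++ D.σ)) C)
    (blockRow m ((m : ℤ) - consecutions 0 (D.σ ++ D.σ₂)) B) A E

end

end EGFP

/-! Everything is done over the block ring `S` of `n × n` matrices over a commutative ring `R`, so
that the pencil is an `m × m` matrix over `S`. Taking `R` to be the polynomials gives (a); taking
`R` to be the rational functions with a finite limit at infinity gives (b).

Canonical form. Write `σ = (s₁, 0, s₂)`. The inverse of `M^P_i` is `M^P_{-i}` for `1 ≤ i < m`, so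
cancelling `M^P_{s₁}` and `M^P_{s₂}` turns `t M^P_τ - M^P_σ` into `t M^P_{τ'} - M^P_0`, where `τ'`
lists `-1, …, -m` in some order. By induction on the size, the leading block of that pencil is
invertible and its Schur complement is `∑ t^j a_j`; each induction step is one Horner step
(`hasSchurComplement_fNeg`, `exists_units_gfp`). The elimination matrices fix `e_m` on the left and
`e_mᵀ` on the right, so they do not disturb a border `e_m ⊗ C`, `e_mᵀ ⊗ B`.

Position of the border. Undoing the cancellation moves `e_m` by `M_{τ₁} M_{σ₁} M^P_{s₁}`. Each
factor `M_i` sends `e_{m-q}` to `e_{m-q-1}` if `i = q + 1` and fixes it if `i ≠ q, q + 1`. The SIP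
excludes `i = q`, so `e_m` climbs exactly `i_0(σ₁, σ)` steps, and `M_{τ₁}` then fixes the result
(`Data.leftFactor_mulVec`). The row border is symmetric, with `c_0(σ, σ₂)`.

Infinity. With `g = C(λE - A)⁻¹B`, which is proper, the coupling term in the transfer function is
exactly the effect of replacing `A_0` by `A_0 + g` in the pencil (`Data.transferFunction_eq`). Thus
`λ⁻¹𝔾` is the reversed pencil with `t = λ⁻¹` and coefficients over the proper ring. Reversing the
block order exchanges `M_i` with `M_{-(m-i)}`, so the canonical form applies again
(`exists_units_gfp_reversal`) and yields `λ^{-m}G`. Units over the proper ring are biproper.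

Irreducibility. One block of `𝔾` is a polynomial block plus `C(λE - A)⁻¹B`, so a smaller realization
of `𝔾` would give a smaller one of `G`. -/

namespace EGFP

/-! ### Elementary matrices over a ring -/

section Elementary

variable {S : Type*} [Ring S]

/-- The elementary matrix `M_i(x)` over a ring. -/
def ePos (m i : ℕ) (x : S) : Matrix (Fin m) (Fin m) S :=
  Matrix.of fun p q =>
    if p.1 + 1 + i = m ∧ q.1 + 1 + i = m then x
    else if p.1 + 1 + i = m ∧ q.1 + i = m then 1
    else if p.1 + i = m ∧ q.1 + 1 + i = m then 1
    else if p.1 + i = m ∧ q.1 + i = m then 0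
    else if p.1 = q.1 then 1 else 0

/-- The elementary matrix `M_{-i}(x)` over a ring. -/
def eNeg (m i : ℕ) (x : S) : Matrix (Fin m) (Fin m) S :=
  Matrix.of fun p q =>
    if p.1 + 1 + i = m ∧ q.1 + 1 + i = m then 0
    else if p.1 + 1 + i = m ∧ q.1 + i = m then 1
    else if p.1 + i = m ∧ q.1 + 1 + i = m then 1
    else if p.1 + i = m ∧ q.1 + i = m then x
    else if p.1 = q.1 then 1 else 0

/-- `diag(1, …, 1, x)`. -/
def dLast (m : ℕ) (x : S) : Matrix (Fin m) (Fin m) S :=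
  Matrix.of fun p q => if p.1 + 1 = m ∧ q.1 + 1 = m then x else if p = q then 1 else 0

/-- The unit vector `e_{m-q}` (positions counted from `1`). -/
def col (S : Type*) [Ring S] (m q : ℕ) : Fin m → S := fun p => if p.1 + 1 + q = m then 1 else 0

theorem col_eq_single {m q : ℕ} (hq : q < m) :
    col S m q = Pi.single (⟨m - 1 - q, by omega⟩ : Fin m) 1 := by
  ext p
  simp only [col, Pi.single_apply, Fin.ext_iff]
  congr 1
  apply propext
  omega

theorem ePos_zero (m : ℕ) (x : S) : ePos m 0 x = dLast m x := by
  ext p q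
  have := p.2
  have := q.2
  simp only [ePos, dLast, Matrix.of_apply, Fin.ext_iff]
  split_ifs <;> first | rfl | omega

/-- The entry `x` lies only in column `m - i`, so every other column of `M_i(x)` is a unit vector
independent of `x`. -/
theorem ePos_mulVec_col {m i q : ℕ} (x : S) (hq : q < m) (hi : i < m) (hne : i ≠ q) :
    (ePos m i x).mulVec (col S m q) = col S m (if i = q + 1 then q + 1 else q) := by
  rw [col_eq_single hq, Matrix.mulVec_single_one]
  ext p
  have := p.2
  simp only [Matrix.col_apply, ePos, Matrix.of_apply, col]
  split_ifs <;> first | rfl | omega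

theorem vecMul_ePos_col {m i q : ℕ} (x : S) (hq : q < m) (hi : i < m) (hne : i ≠ q) :
    Matrix.vecMul (col S m q) (ePos m i x) = col S m (if i = q + 1 then q + 1 else q) := by
  rw [col_eq_single hq, Matrix.single_one_vecMul]
  ext p
  have := p.2
  simp only [Matrix.row_apply, ePos, Matrix.of_apply, col]
  split_ifs <;> first | rfl | omega

/-- `M_{-i}(x)` differs from the identity only in rows and columns `m - i` and `m - i + 1`, the
positions `q = i` and `q = i - 1`. -/
theorem eNeg_mulVec_col {m i q : ℕ} (x : S) (hq : q < m) (h0 : i ≠ q) (h1 : i ≠ q + 1) :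
    (eNeg m i x).mulVec (col S m q) = col S m q := by
  rw [col_eq_single hq, Matrix.mulVec_single_one, ← col_eq_single hq]
  ext p
  have := p.2
  simp only [Matrix.col_apply, eNeg, Matrix.of_apply, col]
  split_ifs <;> first | rfl | omega

theorem vecMul_eNeg_col {m i q : ℕ} (x : S) (hq : q < m) (h0 : i ≠ q) (h1 : i ≠ q + 1) :
    Matrix.vecMul (col S m q) (eNeg m i x) = col S m q := by
  rw [col_eq_single hq, Matrix.single_one_vecMul, ← col_eq_single hq]
  ext p
  have := p.2
  simp only [Matrix.row_apply, eNeg, Matrix.of_apply, col]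
  split_ifs <;> first | rfl | omega

theorem ePos_row {m i : ℕ} (x : S) (hi : i < m) (h0 : 1 ≤ i) :
    (ePos m i x) ⟨m - 1 - i, by omega⟩ =
      Pi.single ⟨m - 1 - i, by omega⟩ x + Pi.single ⟨m - i, by omega⟩ 1 := by
  ext q
  have := q.2
  simp only [ePos, Matrix.of_apply, Pi.add_apply, Pi.single_apply, Fin.ext_iff]
  split_ifs <;> first | (exfalso; omega) | simp

theorem eNeg_row {m i : ℕ} (x : S) (hi : i < m) (h0 : 1 ≤ i) :
    (eNeg m i x) ⟨m - i, by omega⟩ =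
      Pi.single ⟨m - 1 - i, by omega⟩ 1 + Pi.single ⟨m - i, by omega⟩ x := by
  ext q
  have := q.2
  simp only [eNeg, Matrix.of_apply, Pi.add_apply, Pi.single_apply, Fin.ext_iff]
  split_ifs <;> first | (exfalso; omega) | simp

/-- The cores satisfy `[-x, 1; 1, 0] [0, 1; 1, x] = I` with no condition on `x`. Hence `M^P_{-i}`
inverts `M^P_i`, and `M_{±i}(x)` is invertible for every `x` when `1 ≤ i < m`. -/
theorem ePos_neg_mul_eNeg {m i : ℕ} (x : S) (hi : i < m) (h0 : 1 ≤ i) :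
    ePos m i (-x) * eNeg m i x = 1 := by
  ext p q
  have hp := p.2
  have hq := q.2
  by_cases h1 : p.1 + 1 + i = m
  · have hp' : p = ⟨m - 1 - i, by omega⟩ := Fin.ext (by simp; omega)
    rw [Matrix.mul_apply', hp', ePos_row _ hi h0, add_dotProduct, single_dotProduct, single_dotProduct]
    simp only [eNeg, Matrix.of_apply, Matrix.one_apply, Fin.ext_iff]
    split_ifs <;> first | (exfalso; omega) | simp
  by_cases h2 : p.1 + i = m
  · have : ePos m i (-x) p = Pi.single ⟨m - 1 - i, by omega⟩ 1 := by
      ext j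
      simp only [ePos, Matrix.of_apply, Pi.single_apply, Fin.ext_iff]
      split_ifs <;> first | (exfalso; omega) | simp
    rw [Matrix.mul_apply', this, single_dotProduct]
    simp only [eNeg, Matrix.of_apply, Matrix.one_apply, Fin.ext_iff]
    split_ifs <;> first | (exfalso; omega) | simp
  · have : ePos m i (-x) p = Pi.single p 1 := by
      ext j
      simp only [ePos, Matrix.of_apply, Pi.single_apply, Fin.ext_iff]
      split_ifs <;> first | (exfalso; omega) | simp
    rw [Matrix.mul_apply', this, single_dotProduct]
    simp only [eNeg, Matrix.of_apply, Matrix.one_apply, Fin.ext_iff]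
    split_ifs <;> first | (exfalso; omega) | simp

theorem eNeg_mul_ePos_neg {m i : ℕ} (x : S) (hi : i < m) (h0 : 1 ≤ i) :
    eNeg m i x * ePos m i (-x) = 1 := by
  ext p q
  have hp := p.2
  have hq := q.2
  by_cases h2 : p.1 + i = m
  · have hp' : p = ⟨m - i, by omega⟩ := Fin.ext (by simp; omega)
    rw [Matrix.mul_apply', hp', eNeg_row _ hi h0, add_dotProduct, single_dotProduct, single_dotProduct]
    simp only [ePos, Matrix.of_apply, Matrix.one_apply, Fin.ext_iff]
    split_ifs <;> first | (exfalso; omega) | simp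
  by_cases h1 : p.1 + 1 + i = m
  · have : eNeg m i x p = Pi.single ⟨m - i, by omega⟩ 1 := by
      ext j
      simp only [eNeg, Matrix.of_apply, Pi.single_apply, Fin.ext_iff]
      split_ifs <;> first | (exfalso; omega) | simp
    rw [Matrix.mul_apply', this, single_dotProduct]
    simp only [ePos, Matrix.of_apply, Matrix.one_apply, Fin.ext_iff]
    split_ifs <;> first | (exfalso; omega) | simp
  · have : eNeg m i x p = Pi.single p 1 := by
      ext j
      simp only [eNeg, Matrix.of_apply, Pi.single_apply, Fin.ext_iff]
      split_ifs <;> first | (exfalso; omega) | simp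
    rw [Matrix.mul_apply', this, single_dotProduct]
    simp only [ePos, Matrix.of_apply, Matrix.one_apply, Fin.ext_iff]
    split_ifs <;> first | (exfalso; omega) | simp

theorem dLast_one (m : ℕ) : dLast m (1 : S) = 1 := by
  ext p q
  simp only [dLast, Matrix.of_apply, Matrix.one_apply, Fin.ext_iff]
  split_ifs <;> first | rfl | omega

theorem dLast_mul (m : ℕ) (x y : S) : dLast m x * dLast m y = dLast m (x * y) := by
  have h (z : S) : dLast m z = Matrix.diagonal fun p : Fin m => if p.1 + 1 = m then z else 1 := by
    ext p q
    simp only [dLast, Matrix.of_apply, Matrix.diagonal_apply, Fin.ext_iff]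
    split_ifs <;> first | rfl | omega
  rw [h, h, h, Matrix.diagonal_mul_diagonal]
  congr 1
  ext p
  split_ifs <;> simp

theorem isUnit_dLast (m : ℕ) {x : S} (hx : IsUnit x) : IsUnit (dLast m x) := by
  obtain ⟨u, rfl⟩ := hx
  exact ⟨⟨dLast m u, dLast m ↑u⁻¹, by rw [dLast_mul, Units.mul_inv, dLast_one],
    by rw [dLast_mul, Units.inv_mul, dLast_one]⟩, rfl⟩

theorem eNeg_self (m : ℕ) (x : S) :
    eNeg m m x = Matrix.diagonal fun p : Fin m => if p.1 = 0 then x else 1 := by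
  ext p q
  have := p.2
  have := q.2
  simp only [eNeg, Matrix.of_apply, Matrix.diagonal_apply, Fin.ext_iff]
  split_ifs <;> first | rfl | omega

theorem isUnit_eNeg_self (m : ℕ) {x : S} (hx : IsUnit x) : IsUnit (eNeg m m x) := by
  obtain ⟨u, rfl⟩ := hx
  refine ⟨⟨eNeg m m u, eNeg m m ↑u⁻¹, ?_, ?_⟩, rfl⟩ <;>
  · rw [eNeg_self, eNeg_self, Matrix.diagonal_mul_diagonal, ← Matrix.diagonal_one]
    congr 1
    ext p
    split_ifs <;> simp

theorem isUnit_ePos {m i : ℕ} (hi : i < m) {x : S} (hx : i = 0 → IsUnit x) :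
    IsUnit (ePos m i x) := by
  rcases Nat.eq_zero_or_pos i with rfl | h
  · rw [ePos_zero]
    exact isUnit_dLast m (hx rfl)
  · rw [← neg_neg x]
    exact ⟨⟨_, _, ePos_neg_mul_eNeg _ hi h, eNeg_mul_ePos_neg _ hi h⟩, rfl⟩

theorem isUnit_eNeg {m i : ℕ} (hi : i ≤ m) (h : 1 ≤ i) {x : S} (hx : i = m → IsUnit x) :
    IsUnit (eNeg m i x) := by
  rcases hi.eq_or_lt with rfl | hi
  · exact isUnit_eNeg_self i (hx rfl)
  · exact ⟨⟨_, _, eNeg_mul_ePos_neg _ hi h, ePos_neg_mul_eNeg _ hi h⟩, rfl⟩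

/-- `M_{-1}` commutes with `M_{-j}` for `j ≥ 3`. -/
theorem commute_eNeg_one {m j : ℕ} (hj : 3 ≤ j) (x y : S) :
    Commute (eNeg m 1 x) (eNeg m j y) := by
  -- `M_{-1} - 1` lives in the last two rows and columns and `M_{-j} - 1` outside them, so both
  -- products of these differences vanish.
  have key : ∀ p l q : Fin m,
      ((eNeg m 1 x - 1) p l = 0 ∨ (eNeg m j y - 1) l q = 0) ∧
      ((eNeg m j y - 1) p l = 0 ∨ (eNeg m 1 x - 1) l q = 0) := by
    intro p l q
    have := p.2
    have := q.2
    have := l.2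
    have h1 : ∀ a b : Fin m, (a.1 + 2 < m ∨ b.1 + 2 < m) → (eNeg m 1 x - 1) a b = 0 := by
      intro a b hab
      simp only [eNeg, Matrix.sub_apply, Matrix.of_apply, Matrix.one_apply, Fin.ext_iff]
      split_ifs <;> first | (exfalso; omega) | simp
    have h2 : ∀ a b : Fin m, (m ≤ a.1 + 2 ∨ m ≤ b.1 + 2) → (eNeg m j y - 1) a b = 0 := by
      intro a b hab
      simp only [eNeg, Matrix.sub_apply, Matrix.of_apply, Matrix.one_apply, Fin.ext_iff]
      split_ifs <;> first | (exfalso; omega) | simp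
    by_cases h : l.1 + 2 < m
    · exact ⟨.inl (h1 _ _ (.inr h)), .inr (h1 _ _ (.inl h))⟩
    · exact ⟨.inr (h2 _ _ (.inl (by omega))), .inl (h2 _ _ (.inr (by omega)))⟩
  have z1 : (eNeg m 1 x - 1) * (eNeg m j y - 1) = 0 := by
    ext p q
    rw [Matrix.mul_apply]
    exact Finset.sum_eq_zero fun l _ => by rcases (key p l q).1 with h | h <;> simp [h]
  have z2 : (eNeg m j y - 1) * (eNeg m 1 x - 1) = 0 := by
    ext p q
    rw [Matrix.mul_apply]
    exact Finset.sum_eq_zero fun l _ => by rcases (key p l q).2 with h | h <;> simp [h]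
  have : Commute (eNeg m 1 x - 1) (eNeg m j y - 1) := z1.trans z2.symm
  simpa using (this.add_left (Commute.one_left _)).add_right (Commute.one_right _)

end Elementary

/-! ### Matrices with a distinguished last row and column -/

section Bordered

/-- The matrix `[W, u; v, d]` with four blocks of sizes `k` and `1`. -/
def bordered {S : Type*} {k : ℕ} (W : Matrix (Fin k) (Fin k) S) (u v : Fin k → S) (d : S) :
    Matrix (Fin (k + 1)) (Fin (k + 1)) S :=
  Matrix.of fun p q => Fin.lastCases (motive := fun _ => S)
    (Fin.lastCases (motive := fun _ => S) d v q)
    (fun i => Fin.lastCases (motive := fun _ => S) (u i) (fun j => W i j) q) p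

section
variable {S : Type*} {k : ℕ} (W : Matrix (Fin k) (Fin k) S) (u v : Fin k → S) (d : S) (i j : Fin k)

@[simp] theorem bordered_castSucc_castSucc :
    bordered W u v d i.castSucc j.castSucc = W i j := by simp [bordered]

@[simp] theorem bordered_castSucc_last :
    bordered W u v d i.castSucc (Fin.last k) = u i := by simp [bordered]

@[simp] theorem bordered_last_castSucc :
    bordered W u v d (Fin.last k) j.castSucc = v j := by simp [bordered]

@[simp] theorem bordered_last_last :
    bordered W u v d (Fin.last k) (Fin.last k) = d := by simp [bordered]

theorem eq_bordered (K : Matrix (Fin (k + 1)) (Fin (k + 1)) S) :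
    K = bordered (Matrix.of fun i j => K i.castSucc j.castSucc) (fun i => K i.castSucc (Fin.last k))
      (fun j => K (Fin.last k) j.castSucc) (K (Fin.last k) (Fin.last k)) := by
  ext p q
  refine Fin.lastCases ?_ (fun p => ?_) p <;> refine Fin.lastCases ?_ (fun q => ?_) q <;> simp

end

variable {S : Type*} [Ring S] {k : ℕ} (W : Matrix (Fin k) (Fin k) S) (u v : Fin k → S) (d : S)

theorem bordered_mul_bordered (W' : Matrix (Fin k) (Fin k) S) (u' v' : Fin k → S) (d' : S) :
    bordered W u v d * bordered W' u' v' d' =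
      bordered (W * W' + Matrix.vecMulVec u v') (W.mulVec u' + fun i => u i * d')
        (Matrix.vecMul v W' + fun j => d * v' j) (v ⬝ᵥ u' + d * d') := by
  ext p q
  refine Fin.lastCases ?_ (fun p => ?_) p <;> refine Fin.lastCases ?_ (fun q => ?_) q <;>
  simp [Matrix.mul_apply, Fin.sum_univ_castSucc, Matrix.mulVec, Matrix.vecMul, dotProduct,
    Matrix.vecMulVec_apply]

theorem bordered_mulVec_snoc (x : Fin k → S) (y : S) :
    (bordered W u v d).mulVec (Fin.snoc x y : Fin (k + 1) → S) =
      Fin.snoc (W.mulVec x + fun i => u i * y) (v ⬝ᵥ x + d * y) := by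
  ext p
  refine Fin.lastCases ?_ (fun p => ?_) p <;>
  simp [Fin.sum_univ_castSucc, Matrix.mulVec, dotProduct]

theorem snoc_dotProduct_snoc (x x' : Fin k → S) (y y' : S) :
    (Fin.snoc x y : Fin (k + 1) → S) ⬝ᵥ (Fin.snoc x' y' : Fin (k + 1) → S) = x ⬝ᵥ x' + y * y' := by
  simp [dotProduct, Fin.sum_univ_castSucc]

theorem bordered_one : bordered (1 : Matrix (Fin k) (Fin k) S) 0 0 1 = 1 := by
  ext p q
  refine Fin.lastCases ?_ (fun p => ?_) p <;> refine Fin.lastCases ?_ (fun q => ?_) q <;>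
  simp [Matrix.one_apply, Fin.castSucc_ne_last, (Fin.castSucc_ne_last _).symm]

theorem dLast_eq_bordered (x : S) :
    dLast (k + 1) x = bordered (1 : Matrix (Fin k) (Fin k) S) 0 0 x := by
  ext p q
  refine Fin.lastCases ?_ (fun p => ?_) p <;> refine Fin.lastCases ?_ (fun q => ?_) q
  · simp [dLast]
  · simp [dLast, q.2.ne, (Fin.castSucc_ne_last _).symm]
  · simp [dLast, p.2.ne, Fin.castSucc_ne_last]
  · simp [dLast, p.2.ne, Matrix.one_apply]

theorem col_zero_eq_snoc : col S (k + 1) 0 = (Fin.snoc 0 1 : Fin (k + 1) → S) := by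
  ext p
  refine Fin.lastCases ?_ (fun p => ?_) p
  · simp [col]
  · simp [col, p.2.ne]

/-- The leading principal block of size `k` of `K` is invertible, and `q` is its Schur
complement in `K`. -/
def HasSchurComplement (K : Matrix (Fin (k + 1)) (Fin (k + 1)) S) (q : S) : Prop :=
  ∃ (N W : Matrix (Fin k) (Fin k) S) (r b x : Fin k → S) (c : S), K = bordered N r b c ∧
    W * N = 1 ∧ N * W = 1 ∧ N.mulVec x + r = 0 ∧ b ⬝ᵥ x + c = q

/-- Block elimination with the pivot `N`. The left factor is lower triangular with last column
`e_m`, and the right factor is upper triangular with last row `e_mᵀ`, which is why border vectors in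
the last position survive. -/
theorem HasSchurComplement.exists_units {K : Matrix (Fin (k + 1)) (Fin (k + 1)) S} {q : S}
    (h : HasSchurComplement K q) :
    ∃ U V : Matrix (Fin (k + 1)) (Fin (k + 1)) S, IsUnit U ∧ IsUnit V ∧
      U.mulVec (col S (k + 1) 0) = col S (k + 1) 0 ∧
      Matrix.vecMul (col S (k + 1) 0) V = col S (k + 1) 0 ∧ U * K * V = dLast (k + 1) q := by
  obtain ⟨N, W, r, b, x, c, rfl, hWN, hNW, hx, hq⟩ := h
  refine ⟨bordered 1 0 (-Matrix.vecMul b W) 1, bordered W x 0 1,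
    ⟨⟨bordered 1 0 (-Matrix.vecMul b W) 1, bordered 1 0 (Matrix.vecMul b W) 1, ?_, ?_⟩, rfl⟩,
    ⟨⟨bordered W x 0 1, bordered N (-N.mulVec x) 0 1, ?_, ?_⟩, rfl⟩, ?_, ?_, ?_⟩
  · rw [bordered_mul_bordered, ← bordered_one]
    congr 1 <;> simp
    ext; simp
  · rw [bordered_mul_bordered, ← bordered_one]
    congr 1 <;> simp
    · ext; simp
    · ext; simp
  · rw [bordered_mul_bordered, ← bordered_one]
    congr 1 <;> simp [hWN]
    · ext; simp [Matrix.mulVec_neg, hWN]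
    · ext; simp
  · rw [bordered_mul_bordered, ← bordered_one]
    congr 1 <;> simp [hNW]
    · ext; simp
    · ext; simp
  · rw [col_zero_eq_snoc, bordered_mulVec_snoc]
    congr 1 <;> simp
    ext; simp
  · rw [col_zero_eq_snoc]
    ext p
    refine Fin.lastCases ?_ (fun p => ?_) p <;>
    simp [Matrix.vecMul, dotProduct, Fin.sum_univ_castSucc]
  · rw [mul_assoc, bordered_mul_bordered, bordered_mul_bordered, dLast_eq_bordered]
    have hN : (N.mulVec x + fun i => r i * 1) = 0 := by simpa using hx
    congr 1
    · simp [hNW]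
    · rw [hN]; ext; simp
    · ext; simp [hNW]
    · rw [hN]; simp [hq]

/-- A Horner step. With `K = [N, r; b, c]` the new leading block `[N, 0; b, -1]` is triangular, and
`(x, q)` solves the new system because `b x - q + c = 0`; the row `(0, t)` then reads off `t q`. -/
theorem HasSchurComplement.step_right {K : Matrix (Fin (k + 1)) (Fin (k + 1)) S} {q : S}
    (h : HasSchurComplement K q) (t d : S) :
    HasSchurComplement (bordered
      (bordered (Matrix.of fun i j : Fin k => K i.castSucc j.castSucc) 0
        (fun j => K (Fin.last k) j.castSucc) (-1))
      (fun i => K i (Fin.last k)) (Fin.snoc 0 t) d) (t * q + d) := by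
  obtain ⟨N, W, r, b, x, c, rfl, hWN, hNW, hx, hq⟩ := h
  refine ⟨_, bordered W 0 (Matrix.vecMul b W) (-1), _, _, Fin.snoc x q, _, rfl, ?_, ?_, ?_, ?_⟩
  · rw [bordered_mul_bordered, ← bordered_one]
    congr 1
    · ext i j; simp [← hWN, Matrix.mul_apply]
    · ext; simp
    · ext j
      simp only [bordered_castSucc_castSucc, bordered_last_castSucc]
      change Matrix.vecMul (Matrix.vecMul b W) N j + _ = _
      simp [hWN]
    · simp
  · rw [bordered_mul_bordered, ← bordered_one]
    congr 1
    · ext i j; simp [← hNW, Matrix.mul_apply]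
    · ext; simp
    · ext j; simp
    · simp
  · rw [bordered_mulVec_snoc]
    ext p
    refine Fin.lastCases ?_ (fun p => ?_) p
    · simp [← hq]
    · have := congrFun hx p
      simpa [Matrix.mulVec, dotProduct] using this
  · rw [snoc_dotProduct_snoc]
    simp

/-- The mirror image of `step_right`, with leading block `[N, r; 0, -1]` and solution `(x t, t)`.
The complement comes out as `q t + d`, so `t` has to commute with `q`. -/
theorem HasSchurComplement.step_left {K : Matrix (Fin (k + 1)) (Fin (k + 1)) S} {q : S}
    (h : HasSchurComplement K q) {t : S} (ht : ∀ s, Commute t s) (d : S) :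
    HasSchurComplement (bordered
      (bordered (Matrix.of fun i j : Fin k => K i.castSucc j.castSucc)
        (fun i => K i.castSucc (Fin.last k)) 0 (-1))
      (Fin.snoc 0 t) (fun j => K (Fin.last k) j) d) (t * q + d) := by
  obtain ⟨N, W, r, b, x, c, rfl, hWN, hNW, hx, hq⟩ := h
  have hr : r = -N.mulVec x := by rw [eq_neg_iff_add_eq_zero, add_comm, hx]
  refine ⟨_, bordered W (-x) 0 (-1), _, _, Fin.snoc (fun i => x i * t) t, _, rfl, ?_, ?_, ?_, ?_⟩
  · rw [bordered_mul_bordered, ← bordered_one]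
    congr 1
    · ext i j; simp [← hWN, Matrix.mul_apply]
    · simp only [bordered_castSucc_last, hr]
      ext i
      change W.mulVec (-N.mulVec x) i + _ = _
      simp [Matrix.mulVec_neg, hWN]
    · ext; simp
    · simp
  · rw [bordered_mul_bordered, ← bordered_one]
    congr 1
    · ext i j; simp [← hNW, Matrix.mul_apply]
    · simp only [bordered_castSucc_last, hr]
      ext i
      simp [Matrix.mulVec, dotProduct]
    · ext; simp
    · simp
  · rw [bordered_mulVec_snoc]
    ext p
    refine Fin.lastCases ?_ (fun p => ?_) p
    · simp
    · have := congrArg (· * t) (congrFun hx p)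
      simpa [Matrix.mulVec, dotProduct, add_mul, Finset.sum_mul, mul_assoc] using this
  · have hb : (fun j => bordered N r b c (Fin.last k) j) = (Fin.snoc b c : Fin (k + 1) → S) := by
      ext p
      refine Fin.lastCases ?_ (fun p => ?_) p <;> simp
    rw [hb, snoc_dotProduct_snoc, (ht q).eq, ← hq, add_mul]
    simp [dotProduct, Finset.sum_mul, mul_assoc]

end Bordered

/-! ### Fiedler pencils over a ring -/

section Core

variable {R S : Type*} [CommRing R] [Ring S] [Algebra R S]

/-- `M^P_σ` over a ring. -/
def fPos (m : ℕ) (a : ℕ → S) (σ : List ℕ) : Matrix (Fin m) (Fin m) S :=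
  (σ.map fun i => ePos m i (-a i)).prod

/-- `M^P_{-ω}` over a ring. -/
def fNeg (m : ℕ) (a : ℕ → S) (ω : List ℕ) : Matrix (Fin m) (Fin m) S :=
  (ω.map fun i => eNeg m i (a i)).prod

theorem smul_bordered {k : ℕ} (t : R) (W : Matrix (Fin k) (Fin k) S) (u v : Fin k → S)
    (d : S) : t • bordered W u v d = bordered (t • W) (t • u) (t • v) (t • d) := by
  ext p q
  refine Fin.lastCases ?_ (fun p => ?_) p <;> refine Fin.lastCases ?_ (fun q => ?_) q <;> simp

theorem bordered_sub_bordered {k : ℕ} (W W' : Matrix (Fin k) (Fin k) S) (u v u' v' : Fin k → S)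
    (d d' : S) :
    bordered W u v d - bordered W' u' v' d' = bordered (W - W') (u - u') (v - v') (d - d') := by
  ext p q
  refine Fin.lastCases ?_ (fun p => ?_) p <;> refine Fin.lastCases ?_ (fun q => ?_) q <;> simp

theorem fPos_append (m : ℕ) (a : ℕ → S) (σ σ' : List ℕ) :
    fPos m a (σ ++ σ') = fPos m a σ * fPos m a σ' := by simp [fPos]

theorem fPos_cons (m : ℕ) (a : ℕ → S) (i : ℕ) (σ : List ℕ) :
    fPos m a (i :: σ) = ePos m i (-a i) * fPos m a σ := by simp [fPos]

theorem fNeg_append (m : ℕ) (a : ℕ → S) (σ σ' : List ℕ) :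
    fNeg m a (σ ++ σ') = fNeg m a σ * fNeg m a σ' := by simp [fNeg]

theorem fNeg_cons (m : ℕ) (a : ℕ → S) (i : ℕ) (σ : List ℕ) :
    fNeg m a (i :: σ) = eNeg m i (a i) * fNeg m a σ := by simp [fNeg]

theorem fPos_mul_fNeg_reverse {m : ℕ} (a : ℕ → S) {σ : List ℕ} (h : ∀ i ∈ σ, 1 ≤ i ∧ i < m) :
    fPos m a σ * fNeg m a σ.reverse = 1 := by
  induction σ with
  | nil => simp [fPos, fNeg]
  | cons i σ ih =>
    have hi := h i (by simp)
    rw [fPos_cons, List.reverse_cons, fNeg_append, mul_assoc, ← mul_assoc (fPos m a σ),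
      ih fun j hj => h j (by simp [hj]), one_mul]
    simp [fNeg, ePos_neg_mul_eNeg _ hi.2 hi.1]

theorem fNeg_reverse_mul_fPos {m : ℕ} (a : ℕ → S) {σ : List ℕ} (h : ∀ i ∈ σ, 1 ≤ i ∧ i < m) :
    fNeg m a σ.reverse * fPos m a σ = 1 := by
  induction σ with
  | nil => simp [fPos, fNeg]
  | cons i σ ih =>
    have hi := h i (by simp)
    rw [fPos_cons, List.reverse_cons, fNeg_append]
    rw [show fNeg m a [i] = eNeg m i (a i) by simp [fNeg], mul_assoc, ← mul_assoc (eNeg m i (a i)),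
      eNeg_mul_ePos_neg _ hi.2 hi.1, one_mul, ih fun j hj => h j (by simp [hj])]

/-- For `i ≥ 1` the last block is untouched by `M_{-(i+1)}`; deleting it lowers the index by one.
This is the reduction in size for the induction. -/
theorem eNeg_succ_succ (k i : ℕ) (hi : 1 ≤ i) (x : S) :
    eNeg (k + 1) (i + 1) x = bordered (eNeg k i x) 0 0 1 := by
  ext p q
  refine Fin.lastCases ?_ (fun p => ?_) p <;> refine Fin.lastCases ?_ (fun q => ?_) q
  · simp only [eNeg, Matrix.of_apply, bordered_last_last, Fin.val_last]
    split_ifs <;> first | rfl | omega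
  · have := q.2
    simp only [eNeg, Matrix.of_apply, bordered_last_castSucc, Fin.val_last, Fin.val_castSucc,
      Pi.zero_apply]
    split_ifs <;> first | rfl | omega
  · have := p.2
    simp only [eNeg, Matrix.of_apply, bordered_castSucc_last, Fin.val_last, Fin.val_castSucc,
      Pi.zero_apply]
    split_ifs <;> first | rfl | omega
  · simp only [eNeg, Matrix.of_apply, bordered_castSucc_castSucc, Fin.val_castSucc]
    split_ifs <;> first | rfl | omega

theorem fNeg_succ (k : ℕ) (a : ℕ → S) {τ : List ℕ} (h : ∀ i ∈ τ, 2 ≤ i) :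
    fNeg (k + 1) a τ = bordered (fNeg k (fun i => a (i + 1)) (τ.map (· - 1))) 0 0 1 := by
  induction τ with
  | nil => simp [fNeg, bordered_one]
  | cons i τ ih =>
    obtain ⟨j, rfl⟩ := Nat.exists_eq_add_of_le (h i (by simp))
    rw [fNeg_cons, ih fun j hj => h j (by simp [hj]), List.map_cons, fNeg_cons,
      show 2 + j = (j + 1) + 1 by ring, eNeg_succ_succ k (j + 1) (by omega), bordered_mul_bordered]
    congr 1
    · simp
    · ext; simp
    · ext; simp
    · simp

theorem eNeg_one_eq_bordered (k : ℕ) (x : S) :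
    eNeg (k + 2) 1 x =
      bordered (dLast (k + 1) (0 : S)) (Fin.snoc 0 1) (Fin.snoc 0 1) x := by
  ext p q
  refine Fin.lastCases ?_ (fun p => ?_) p <;> refine Fin.lastCases ?_ (fun q => ?_) q
  · simp [eNeg]
  · refine Fin.lastCases ?_ (fun q => ?_) q
    · simp [eNeg]
    · have := q.2
      simp only [eNeg, Matrix.of_apply, bordered_last_castSucc, Fin.snoc_castSucc, Pi.zero_apply,
        Fin.val_last, Fin.val_castSucc]
      split_ifs <;> first | rfl | omega
  · refine Fin.lastCases ?_ (fun p => ?_) p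
    · simp [eNeg]
    · have := p.2
      simp only [eNeg, Matrix.of_apply, bordered_castSucc_last, Fin.snoc_castSucc, Pi.zero_apply,
        Fin.val_last, Fin.val_castSucc]
      split_ifs <;> first | rfl | omega
  · have := p.2
    have := q.2
    simp only [eNeg, dLast, Matrix.of_apply, bordered_castSucc_castSucc, Fin.val_castSucc,
      Fin.ext_iff]
    split_ifs <;> first | rfl | omega

/-- The result has the shape needed in `HasSchurComplement.step_right`; subtracting `diag(1, …, 1,
0)` will put the `-1` into the corner of the leading block. -/
theorem bordered_mul_eNeg_one (k : ℕ) (N : Matrix (Fin (k + 1)) (Fin (k + 1)) S) (x : S) :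
    bordered N 0 0 1 * eNeg (k + 2) 1 x = bordered
      (bordered (Matrix.of fun i j : Fin k => N i.castSucc j.castSucc) 0
        (fun j => N (Fin.last k) j.castSucc) 0)
      (fun i => N i (Fin.last k)) (Fin.snoc 0 1) x := by
  obtain ⟨N, u, v, d, rfl⟩ : ∃ A u v d, N = bordered A u v d := ⟨_, _, _, _, eq_bordered N⟩
  rw [eNeg_one_eq_bordered, bordered_mul_bordered, dLast_eq_bordered, bordered_mul_bordered, bordered_mulVec_snoc]
  congr 1
  · ext p q
    refine Fin.lastCases ?_ (fun p => ?_) p <;> refine Fin.lastCases ?_ (fun q => ?_) q <;>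
    simp
  · ext p
    refine Fin.lastCases ?_ (fun p => ?_) p <;> simp
  · ext; simp
  · simp

theorem eNeg_one_mul_bordered (k : ℕ) (N : Matrix (Fin (k + 1)) (Fin (k + 1)) S) (x : S) :
    eNeg (k + 2) 1 x * bordered N 0 0 1 = bordered
      (bordered (Matrix.of fun i j : Fin k => N i.castSucc j.castSucc)
        (fun i => N i.castSucc (Fin.last k)) 0 0)
      (Fin.snoc 0 1) (fun j => N (Fin.last k) j) x := by
  obtain ⟨N, u, v, d, rfl⟩ : ∃ A u v d, N = bordered A u v d := ⟨_, _, _, _, eq_bordered N⟩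
  rw [eNeg_one_eq_bordered, bordered_mul_bordered, dLast_eq_bordered, bordered_mul_bordered]
  congr 1
  · ext p q
    refine Fin.lastCases ?_ (fun p => ?_) p <;> refine Fin.lastCases ?_ (fun q => ?_) q <;>
    simp
  · ext p
    refine Fin.lastCases ?_ (fun p => ?_) p <;> simp
  · ext p
    refine Fin.lastCases ?_ (fun p => ?_) p <;>
    simp [Matrix.vecMul, dotProduct, Fin.sum_univ_castSucc]
  · simp

/-- The canonical form of `λ M_τ - M_0` with the entry `-a 0` of `M_0` left out. -/
theorem hasSchurComplement_fNeg {R S : Type*} [CommRing R] [Ring S] [Algebra R S] (t : R) (k : ℕ)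
    (a : ℕ → S) {τ : List ℕ} (h : τ.Perm (List.range' 1 (k + 1))) :
    HasSchurComplement (t • fNeg (k + 1) a τ - dLast (k + 1) 0)
      (∑ j ∈ Finset.range (k + 1), t ^ (j + 1) • a (j + 1)) := by
  induction k generalizing a τ with
  | zero =>
    obtain rfl : τ = [1] := by simpa using h
    -- The leading block is empty, so the complement is the single entry itself.
    refine ⟨0, 0, 0, 0, 0, t • a 1, ?_, ?_, ?_, ?_, ?_⟩
    · ext p q
      refine Fin.lastCases ?_ (fun p => p.elim0) p
      refine Fin.lastCases ?_ (fun q => q.elim0) q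
      rw [bordered_last_last]
      simp [fNeg, eNeg, dLast]
    · exact Subsingleton.elim _ _
    · exact Subsingleton.elim _ _
    · exact Subsingleton.elim _ _
    · simp
  | succ k ih =>
    have h1 : 1 ∈ τ := h.mem_iff.2 (by simp)
    have hnd : τ.Nodup := h.nodup_iff.2 List.nodup_range'
    obtain ⟨τ₁, τ₂, rfl⟩ := List.append_of_mem h1
    have hp : (τ₁ ++ τ₂).Perm (List.range' 2 (k + 1)) := by
      have := List.perm_middle.symm.trans h
      rw [List.range'_succ] at this
      exact this.cons_inv
    have h2 : ∀ i ∈ τ₁ ++ τ₂, 2 ≤ i := fun i hi => by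
      have := hp.mem_iff.1 hi
      rw [List.mem_range'_1] at this
      exact this.1
    have hp' : ((τ₁ ++ τ₂).map (· - 1)).Perm (List.range' 1 (k + 1)) := by
      have := hp.map (· - 1)
      rwa [show (List.range' 2 (k + 1)).map (· - 1) = List.range' 1 (k + 1) by
        rw [List.map_sub_range' (by simp)]] at this
    -- Horner's scheme: the complement for the shifted coefficients is multiplied by `t`, and `t • a
    -- 1` is added.
    have hsum : (∑ j ∈ Finset.range (k + 1 + 1), t ^ (j + 1) • a (j + 1)) =
        algebraMap R S t * (∑ j ∈ Finset.range (k + 1), t ^ (j + 1) • a (j + 1 + 1)) +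
          t • a 1 := by
      rw [Finset.sum_range_succ', ← Algebra.smul_def, Finset.smul_sum]
      simp only [smul_smul, ← pow_succ', zero_add, pow_one]
    -- Only `M_{-2}` can block `M_{-1}`, and it occurs at most once in the product. So `M_{-1}`
    -- moves to the left end if `2` stands to its right, and to the right end otherwise.
    have hc : ∀ w : List ℕ, (∀ i ∈ w, 2 ≤ i) → 2 ∉ w →
        Commute (eNeg (k + 2) 1 (a 1)) (fNeg (k + 2) a w) := by
      intro w hw hw2
      refine Commute.list_prod_right _ _ fun M hM => ?_
      obtain ⟨i, hi, rfl⟩ := List.mem_map.1 hM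
      refine commute_eNeg_one ?_ _ _
      have := hw i hi
      have : i ≠ 2 := fun h => hw2 (h ▸ hi)
      omega
    have ih' := ih (fun i => a (i + 1)) hp'
    rw [hsum, dLast_eq_bordered]
    by_cases h2' : 2 ∈ τ₂
    · have h21 : 2 ∉ τ₁ := fun h => by
        have := List.disjoint_of_nodup_append hnd h
        simp [h2'] at this
      have e : fNeg (k + 1 + 1) a (τ₁ ++ 1 :: τ₂) =
          eNeg (k + 2) 1 (a 1) * fNeg (k + 2) a (τ₁ ++ τ₂) := by
        rw [fNeg_append, fNeg_cons, ← mul_assoc,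
          ← (hc τ₁ (fun i hi => h2 i (by simp [hi])) h21).eq, mul_assoc, fNeg_append]
      rw [e, fNeg_succ (k + 1) a h2, eNeg_one_mul_bordered]
      convert ih'.step_left (t := algebraMap R S t) (fun s => Algebra.commutes t s) (t • a 1) using 1
      rw [smul_bordered, bordered_sub_bordered]
      congr 1
      · ext p q
        refine Fin.lastCases ?_ (fun p => ?_) p <;> refine Fin.lastCases ?_ (fun q => ?_) q <;>
        simp [dLast_eq_bordered, Matrix.one_apply, Fin.castSucc_ne_last,
          (Fin.castSucc_ne_last _).symm]
      · ext p
        refine Fin.lastCases ?_ (fun p => ?_) p <;> simp [Algebra.algebraMap_eq_smul_one]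
      · ext p
        refine Fin.lastCases ?_ (fun p => ?_) p <;> simp [dLast_eq_bordered]
      · simp
    · have e : fNeg (k + 1 + 1) a (τ₁ ++ 1 :: τ₂) =
          fNeg (k + 2) a (τ₁ ++ τ₂) * eNeg (k + 2) 1 (a 1) := by
        rw [fNeg_append, fNeg_cons, (hc τ₂ (fun i hi => h2 i (by simp [hi])) h2').eq, ← mul_assoc,
          fNeg_append]
      rw [e, fNeg_succ (k + 1) a h2, bordered_mul_eNeg_one]
      convert ih'.step_right (algebraMap R S t) (t • a 1) using 1
      rw [smul_bordered, bordered_sub_bordered]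
      congr 1
      · ext p q
        refine Fin.lastCases ?_ (fun p => ?_) p <;> refine Fin.lastCases ?_ (fun q => ?_) q <;>
        simp [dLast_eq_bordered, Matrix.one_apply, Fin.castSucc_ne_last,
          (Fin.castSucc_ne_last _).symm]
      · ext p
        refine Fin.lastCases ?_ (fun p => ?_) p <;> simp [dLast_eq_bordered]
      · ext p
        refine Fin.lastCases ?_ (fun p => ?_) p <;> simp [Algebra.algebraMap_eq_smul_one]
      · simp

end Core

/-! ### Canonical forms of generalized Fiedler pencils and of their reversals -/

section Fiedler

/-- Changing the corner entry shifts the complement by the same amount; this restores the entry `-a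
0` of `M_0`. -/
theorem HasSchurComplement.add_corner {S : Type*} [Ring S] {k : ℕ}
    {K : Matrix (Fin (k + 1)) (Fin (k + 1)) S} {q : S} (h : HasSchurComplement K q) (x : S) :
    HasSchurComplement (K + bordered 0 0 0 x) (x + q) := by
  obtain ⟨N, W, r, b, y, c, rfl, hWN, hNW, hx, hq⟩ := h
  refine ⟨N, W, r, b, y, c + x, ?_, hWN, hNW, hx, by rw [← hq]; abel⟩
  ext p q
  refine Fin.lastCases ?_ (fun p => ?_) p <;> refine Fin.lastCases ?_ (fun q => ?_) q <;> simp

variable {R S : Type*} [CommRing R] [Ring S] [Algebra R S]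

/-- The canonical form of a generalized Fiedler pencil. -/
theorem exists_units_gfp (t : R) {m : ℕ} (a : ℕ → S) {σ₁ σ₂ ω : List ℕ}
    (h : ((σ₁ ++ 0 :: σ₂) ++ ω).Perm (List.range (m + 1))) (hm : m ∈ ω) :
    ∃ U V : Matrix (Fin m) (Fin m) S, IsUnit U ∧ IsUnit V ∧
      U * (t • fNeg m a ω - fPos m a (σ₁ ++ 0 :: σ₂)) * V =
        dLast m (∑ j ∈ Finset.range (m + 1), t ^ j • a j) ∧
      (U * fPos m a σ₁).mulVec (col S m 0) = col S m 0 ∧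
      Matrix.vecMul (col S m 0) (fPos m a σ₂ * V) = col S m 0 := by
  have hnd : ((σ₁ ++ 0 :: σ₂) ++ ω).Nodup := h.nodup_iff.2 List.nodup_range
  have hp : (σ₁ ++ σ₂ ++ ω).Perm (List.range' 1 m) := by
    have h' := h
    rw [List.append_assoc, List.cons_append] at h'
    have := List.perm_middle.symm.trans h'
    rw [List.range_eq_range', List.range'_succ] at this
    simpa using this.cons_inv
  have hσ : ∀ i ∈ σ₁ ++ σ₂, 1 ≤ i ∧ i < m := by
    intro i hi
    have h1 := hp.mem_iff.1 (List.mem_append_left ω hi)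
    rw [List.mem_range'_1] at h1
    have h2 : i ≠ m := by
      rintro rfl
      refine List.disjoint_of_nodup_append hnd (a := i) ?_ hm
      simp only [List.mem_append, List.mem_cons] at hi ⊢
      tauto
    omega
  have hσ₁ : ∀ i ∈ σ₁, 1 ≤ i ∧ i < m := fun i hi => hσ i (by simp [hi])
  have hσ₂ : ∀ i ∈ σ₂, 1 ≤ i ∧ i < m := fun i hi => hσ i (by simp [hi])
  obtain ⟨k, rfl⟩ : ∃ k, m = k + 1 := by
    refine ⟨m - 1, ?_⟩
    have := hp.mem_iff.1 (show m ∈ σ₁ ++ σ₂ ++ ω by simp_all)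
    rw [List.mem_range'_1] at this
    omega
  -- Multiplication by the inverses `M^P_{-rev σ₁}` and `M^P_{-rev σ₂}` moves the indices other than
  -- `0` from `σ` to `τ`, leaving only `M_0` on the other side.
  have hτ : (σ₁.reverse ++ ω ++ σ₂.reverse).Perm (List.range' 1 (k + 1)) := by
    refine List.Perm.trans ?_ hp
    rw [List.append_assoc, List.append_assoc]
    exact σ₁.reverse_perm.append ((List.Perm.append_left ω σ₂.reverse_perm).trans
      List.perm_append_comm)
  obtain ⟨U, V, hU, hV, hU0, hV0, hUV⟩ :=
    ((hasSchurComplement_fNeg t k a hτ).add_corner (a 0)).exists_units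
  have hcor : dLast (k + 1) (-a 0) = dLast (k + 1) 0 - bordered 0 0 0 (a 0) := by
    rw [dLast_eq_bordered, dLast_eq_bordered, bordered_sub_bordered]
    simp
  have hsum : ∑ j ∈ Finset.range (k + 1 + 1), t ^ j • a j =
      a 0 + ∑ j ∈ Finset.range (k + 1), t ^ (j + 1) • a (j + 1) := by
    rw [Finset.sum_range_succ', add_comm]
    simp
  have i1 := fPos_mul_fNeg_reverse a hσ₁
  have i2 := fNeg_reverse_mul_fPos a hσ₁
  have i3 := fPos_mul_fNeg_reverse a hσ₂
  have i4 := fNeg_reverse_mul_fPos a hσ₂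
  refine ⟨U * fNeg (k + 1) a σ₁.reverse, fNeg (k + 1) a σ₂.reverse * V,
    hU.mul ⟨⟨_, _, i2, i1⟩, rfl⟩, IsUnit.mul ⟨⟨_, _, i4, i3⟩, rfl⟩ hV, ?_, ?_, ?_⟩
  · rw [hsum, ← hUV, fPos_append, fPos_cons, neg_eq_iff_eq_neg.2 (neg_neg _).symm, ePos_zero,
      fNeg_append, fNeg_append, sub_add, ← hcor]
    calc _ = U * (t • (fNeg (k + 1) a σ₁.reverse * fNeg (k + 1) a ω * fNeg (k + 1) a σ₂.reverse)
          - fNeg (k + 1) a σ₁.reverse * fPos (k + 1) a σ₁ * dLast (k + 1) (-a 0) *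
            (fPos (k + 1) a σ₂ * fNeg (k + 1) a σ₂.reverse)) * V := by
          simp only [mul_sub, sub_mul, mul_assoc, smul_mul_assoc, mul_smul_comm]
      _ = _ := by rw [i2, i3, one_mul, mul_one]
  · rw [mul_assoc, i2, mul_one, hU0]
  · rw [← mul_assoc, i3, one_mul, hV0]

/-- Reversing the block order turns the core `[0, 1; 1, x]` into `[x, 1; 1, 0]` and moves blocks `m
- i, m - i + 1` to `i, i + 1`. -/
theorem submatrix_rev_eNeg {m i : ℕ} (hi : i ≤ m) (x : S) :
    (eNeg m i x).submatrix Fin.rev Fin.rev = ePos m (m - i) x := by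
  ext p q
  have := p.2
  have := q.2
  simp only [eNeg, ePos, Matrix.submatrix_apply, Matrix.of_apply, Fin.val_rev]
  split_ifs <;> first | rfl | omega

theorem submatrix_rev_ePos {m i : ℕ} (hi : i < m) (x : S) :
    (ePos m i x).submatrix Fin.rev Fin.rev = eNeg m (m - i) x := by
  ext p q
  have := p.2
  have := q.2
  simp only [eNeg, ePos, Matrix.submatrix_apply, Matrix.of_apply, Fin.val_rev]
  split_ifs <;> first | rfl | omega

theorem fPos_map_sub {m : ℕ} (a : ℕ → S) {ω : List ℕ} (h : ∀ i ∈ ω, 1 ≤ i ∧ i ≤ m) :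
    fPos m (fun j => -a (m - j)) (ω.map (m - ·)) = (fNeg m a ω).submatrix Fin.rev Fin.rev := by
  change _ = Matrix.reindexAlgEquiv ℤ S Fin.revPerm (fNeg m a ω)
  rw [fNeg, map_list_prod, fPos, List.map_map, List.map_map]
  refine congrArg List.prod (List.map_congr_left fun i hi => ?_)
  have := h i hi
  simp only [Function.comp_apply, neg_neg, show m - (m - i) = i by omega]
  exact (submatrix_rev_eNeg this.2 _).symm

theorem fNeg_map_sub {m : ℕ} (a : ℕ → S) {σ : List ℕ} (h : ∀ i ∈ σ, i < m) :
    fNeg m (fun j => -a (m - j)) (σ.map (m - ·)) = (fPos m a σ).submatrix Fin.rev Fin.rev := by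
  change _ = Matrix.reindexAlgEquiv ℤ S Fin.revPerm (fPos m a σ)
  rw [fPos, map_list_prod, fNeg, List.map_map, List.map_map]
  refine congrArg List.prod (List.map_congr_left fun i hi => ?_)
  have := h i hi
  simp only [Function.comp_apply, show m - (m - i) = i by omega]
  exact (submatrix_rev_ePos this _).symm

/-- The canonical form of the reversal of a generalized Fiedler pencil. -/
theorem exists_units_gfp_reversal (t : R) {m : ℕ} (a : ℕ → S) {σ ω : List ℕ}
    (h : (σ ++ ω).Perm (List.range (m + 1))) (h0 : 0 ∈ σ) (hm : m ∈ ω) :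
    ∃ U V : Matrix (Fin m) (Fin m) S, IsUnit U ∧ IsUnit V ∧
      U * (fNeg m a ω - t • fPos m a σ) * V =
        dLast m (∑ j ∈ Finset.range (m + 1), t ^ j • a (m - j)) := by
  have hnd : (σ ++ ω).Nodup := h.nodup_iff.2 List.nodup_range
  have hdis := List.disjoint_of_nodup_append hnd
  have hle : ∀ i ∈ σ ++ ω, i ≤ m := fun i hi => by
    have := h.mem_iff.1 hi
    rw [List.mem_range] at this
    omega
  have hσ : ∀ i ∈ σ, i < m := fun i hi =>
    lt_of_le_of_ne (hle i (by simp [hi])) fun e => hdis hi (e ▸ hm)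
  have hω : ∀ i ∈ ω, 1 ≤ i ∧ i ≤ m := fun i hi =>
    ⟨Nat.one_le_iff_ne_zero.2 fun e => hdis h0 (e ▸ hi), hle i (by simp [hi])⟩
  have hmem : 0 ∈ ω.map (m - ·) := List.mem_map.2 ⟨m, hm, by simp⟩
  obtain ⟨s₁, s₂, hs⟩ := List.append_of_mem hmem
  have hperm : ((s₁ ++ 0 :: s₂) ++ σ.map (m - ·)).Perm (List.range (m + 1)) := by
    rw [← hs, ← List.map_append]
    refine ((List.perm_append_comm.trans h).map _).trans ?_
    have : (List.range (m + 1)).map (m - ·) = (List.range (m + 1)).reverse := by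
      rw [List.range_eq_range', List.reverse_range', ← List.range_eq_range']
      simp
    rw [this]
    exact List.reverse_perm _
  -- After the flip `ω` plays the role of `σ` and conversely. `M_i` carries `-A_i` while `M_{-i}`
  -- carries `A_i`, hence the sign in the flipped coefficients `-a (m - j)`.
  obtain ⟨U, V, hU, hV, hUV, -⟩ := exists_units_gfp t (fun j => -a (m - j)) hperm
    (List.mem_map.2 ⟨0, h0, by simp⟩)
  rw [← hs, fPos_map_sub a hω, fNeg_map_sub a hσ] at hUV
  set J : Matrix (Fin m) (Fin m) S := (1 : Matrix (Fin m) (Fin m) S).submatrix Fin.rev id with hJ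
  have hJl (M : Matrix (Fin m) (Fin m) S) : J * M = M.submatrix Fin.rev id :=
    Matrix.one_submatrix_mul Fin.rev (Equiv.refl _) M
  have hJr (M : Matrix (Fin m) (Fin m) S) : M * J = M.submatrix id Fin.rev := by
    rw [show J = (1 : Matrix (Fin m) (Fin m) S).submatrix id Fin.rev by
      ext p q; simp [hJ, Matrix.one_apply, Fin.rev_eq_iff]]
    exact Matrix.mul_submatrix_one (Equiv.refl _) Fin.rev M
  have hJJ : J * J = 1 := by
    rw [hJl, hJ]
    ext p q
    change (1 : Matrix (Fin m) (Fin m) S) p.rev.rev q = (1 : Matrix (Fin m) (Fin m) S) p q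
    rw [Fin.rev_rev]
  have hJu : IsUnit J := ⟨⟨J, J, hJJ, hJJ⟩, rfl⟩
  -- The overall sign restores the order of the difference, and `dLast m (-1)` undoes the sign of
  -- the coefficients.
  refine ⟨-(dLast m (-1) * U * J), J * V,
    (((isUnit_dLast m isUnit_one.neg).mul hU).mul hJu).neg, hJu.mul hV, ?_⟩
  calc _ = dLast m (-1) * (U * (t • (J * fPos m a σ * J) - J * fNeg m a ω * J) * V) := by
        simp only [mul_sub, sub_mul, mul_assoc, smul_mul_assoc, mul_smul_comm, neg_mul,
          smul_neg]
        abel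
    _ = _ := by
        rw [hJl, hJr, hJl, hJr, Matrix.submatrix_submatrix, Matrix.submatrix_submatrix]
        simp only [Function.comp_id, Function.id_comp]
        rw [hUV, dLast_mul]
        simp

end Fiedler

/-! ### Consecutions and inversions -/

/-- Reading `w` from left to right, `p` is replaced by `p + 1` at each entry `p + 1`. -/
def climb (p : ℕ) (w : List ℕ) : ℕ := w.foldl (fun p i => if i = p + 1 then p + 1 else p) p

@[simp] theorem climb_nil (p : ℕ) : climb p [] = p := rfl

theorem climb_cons (p i : ℕ) (w : List ℕ) :
    climb p (i :: w) = climb (if i = p + 1 then p + 1 else p) w := rfl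

/-- While `w` is read, the current value does not occur. -/
def Climbable : ℕ → List ℕ → Prop
  | _, [] => True
  | p, i :: w => i ≠ p ∧ Climbable (if i = p + 1 then p + 1 else p) w

/-- Greedy matching is optimal: `climb` takes each successor at its first opportunity. -/
theorem range'_sublist_iff_climb (p k : ℕ) (w : List ℕ) :
    (List.range' (p + 1) k).Sublist w ↔ p + k ≤ climb p w := by
  induction w generalizing p k with
  | nil => cases k <;> simp [List.range'_succ]
  | cons i w ih =>
    rw [climb_cons]
    cases k with
    | zero =>
      have := (ih (if i = p + 1 then p + 1 else p) 0).1 (by simp)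
      simp only [List.range'_zero, List.nil_sublist, true_iff]
      split_ifs at this ⊢ <;> omega
    | succ k =>
      rw [List.range'_succ]
      split_ifs with h
      · subst h
        rw [List.cons_sublist_cons, ih]
        omega
      · rw [← ih, List.range'_succ]
        refine ⟨fun hs => ?_, fun hs => hs.cons _⟩
        cases hs with
        | cons _ hs => exact hs
        | cons_cons _ hs => exact absurd rfl h

theorem climb_le (p : ℕ) (w : List ℕ) : climb p w ≤ p + w.length := by
  induction w generalizing p with
  | nil => simp
  | cons i w ih =>
    rw [climb_cons, List.length_cons]
    have := ih (if i = p + 1 then p + 1 else p)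
    split_ifs at this ⊢ <;> omega

theorem climb_mem (p : ℕ) (w : List ℕ) : climb p w = p ∨ climb p w ∈ w := by
  induction w generalizing p with
  | nil => simp
  | cons i w ih =>
    rw [climb_cons]
    rcases ih (if i = p + 1 then p + 1 else p) with h | h
    · rw [h]
      split_ifs with hi
      · simp [hi]
      · simp
    · simp [h]

theorem sublist_append_cons_iff {x : ℕ} {s l w : List ℕ} (h : x ∉ l) :
    (x :: s).Sublist (l ++ x :: w) ↔ s.Sublist w := by
  induction l with
  | nil => simp
  | cons y l ih =>
    rw [← ih fun h' => h (by simp [h'])]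
    refine ⟨fun hs => ?_, fun hs => hs.cons _⟩
    cases hs with
    | cons _ hs => exact hs
    | cons_cons _ hs => simp at h

/-- A chain `(0, 1, …, p)` may as well start at the first `0`; the rest is greedy. -/
theorem consecutions_append_cons {l w : List ℕ} (h : 0 ∉ l) :
    consecutions 0 (l ++ 0 :: w) = climb 0 w := by
  have key (p : ℕ) : (List.range' 0 (p + 1)).Sublist (l ++ 0 :: w) ↔ p ≤ climb 0 w := by
    rw [List.range'_succ, sublist_append_cons_iff h, range'_sublist_iff_climb, zero_add]
  rw [consecutions, if_pos (by simp), Nat.cast_inj, Nat.findGreatest_eq_iff]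
  refine ⟨?_, fun _ => (key _).2 le_rfl, fun q hq _ hs => ?_⟩
  · have := climb_le 0 w
    simp
    omega
  · exact absurd ((key q).1 hs) (by omega)

theorem inversions_eq_consecutions_reverse (t : ℕ) (α : List ℕ) :
    inversions t α = consecutions t α.reverse := by
  simp only [inversions, consecutions, List.mem_reverse, List.length_reverse]
  congr 4
  ext q
  rw [← List.reverse_sublist, List.reverse_reverse]

/-- The Successor Infix Property in terms of decompositions of a tuple. -/
theorem SIP.mem_of_append {α : List ℤ} (h : SIP α) {k : ℤ} {u v w : List ℤ}
    (hα : α = u ++ k :: v ++ k :: w) : k + 1 ∈ v := by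
  have e1 : α[u.length]? = some k := by simp [hα]
  have e2 : α[u.length + 1 + v.length]? = some k := by
    rw [hα, List.getElem?_append_right (by simp; omega)]
    simp [show u.length + 1 + v.length - (u.length + (v.length + 1)) = 0 by omega]
  obtain ⟨l1, e1⟩ := List.getElem?_eq_some_iff.1 e1
  obtain ⟨l2, e2⟩ := List.getElem?_eq_some_iff.1 e2
  obtain ⟨c, hac, hcb, hc⟩ := h u.length (u.length + 1 + v.length) l2 (by omega) (e1.trans e2.symm)
  rw [e1] at hc
  have e3 : α[c]? = some (k + 1) := List.getElem?_eq_some_iff.2 ⟨_, hc⟩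
  obtain ⟨d, rfl⟩ := Nat.exists_eq_add_of_lt hac
  rw [hα, List.append_assoc, List.getElem?_append_right (by omega),
    show u.length + d + 1 - u.length = d + 1 by omega, List.cons_append,
    List.getElem?_cons_succ, List.getElem?_append_left (by omega)] at e3
  exact List.mem_of_getElem? e3

/-- A second `p` read while the value is still `p` would be preceded by a `p + 1` in between, at
which the value would already have increased. -/
theorem climbable_of_infix {p : ℕ} {w : List ℕ}
    (h : ∀ k u v w', p :: w = u ++ k :: v ++ k :: w' → k + 1 ∈ v) : Climbable p w := by
  -- `x` is the part read since the value became `p`; it contains no `p + 1`.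
  suffices H : ∀ (w : List ℕ) (p : ℕ) (x : List ℕ),
      (∀ k u v w', p :: x ++ w = u ++ k :: v ++ k :: w' → k + 1 ∈ v) → p + 1 ∉ x →
      Climbable p w from H w p [] (by simpa using h) (by simp)
  clear h w p
  intro w
  induction w with
  | nil => intros; trivial
  | cons i w ih =>
    intro p x h hx
    refine ⟨?_, ?_⟩
    · rintro rfl
      exact hx (h i [] x w (by simp))
    · split_ifs with hi
      · subst hi
        refine ih (p + 1) [] (fun k u v w' e => h k (p :: x ++ u) v w' ?_) (by simp)
        simp only [List.cons_append, List.nil_append] at e ⊢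
        rw [e]
        simp
      · refine ih p (x ++ [i]) (fun k u v w' e => h k u v w' ?_) ?_
        · rw [← e]
          simp
        · simp [hx, Ne.symm hi]

/-! ### Products of elementary matrices acting on unit vectors -/

section Action

variable {S : Type*} [Ring S]

/-- The rightmost factor acts first on a column, so the tuple is read backwards; this is what turns
consecutions into inversions. -/
theorem prod_ePos_mulVec_col {m : ℕ} (l : List (ℕ × S)) (hl : ∀ i ∈ l, i.1 < m) {p : ℕ}
    (hp : p < m) (hc : Climbable p (l.map Prod.fst).reverse) :
    ((l.map fun i => ePos m i.1 i.2).prod).mulVec (col S m p) =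
      col S m (climb p (l.map Prod.fst).reverse) := by
  induction l using List.reverseRecOn generalizing p with
  | nil => simp
  | append_singleton l i ih =>
    have hi := hl i (by simp)
    simp only [List.map_append, List.map_cons, List.map_nil, List.reverse_append,
      List.reverse_singleton, List.singleton_append, List.prod_append, List.prod_singleton] at hc ⊢
    obtain ⟨h1, h2⟩ := hc
    rw [climb_cons, ← Matrix.mulVec_mulVec, ePos_mulVec_col _ hp hi h1]
    exact ih (fun j hj => hl j (by simp [hj])) (by split_ifs <;> omega) h2

theorem vecMul_col_prod_ePos {m : ℕ} (l : List (ℕ × S)) (hl : ∀ i ∈ l, i.1 < m) {p : ℕ}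
    (hp : p < m) (hc : Climbable p (l.map Prod.fst)) :
    Matrix.vecMul (col S m p) ((l.map fun i => ePos m i.1 i.2).prod) =
      col S m (climb p (l.map Prod.fst)) := by
  induction l generalizing p with
  | nil => simp
  | cons i l ih =>
    have hi := hl i (by simp)
    simp only [List.map_cons, List.prod_cons] at hc ⊢
    obtain ⟨h1, h2⟩ := hc
    rw [climb_cons, ← Matrix.vecMul_vecMul, vecMul_ePos_col _ hp hi h1]
    exact ih (fun j hj => hl j (by simp [hj])) (by split_ifs <;> omega) h2

theorem prod_eNeg_mulVec_col {m : ℕ} (l : List (ℕ × S)) {p : ℕ} (hp : p < m)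
    (hl : ∀ i ∈ l, i.1 ≠ p ∧ i.1 ≠ p + 1) :
    ((l.map fun i => eNeg m i.1 i.2).prod).mulVec (col S m p) = col S m p := by
  induction l with
  | nil => simp
  | cons i l ih =>
    have hi := hl i (by simp)
    rw [List.map_cons, List.prod_cons, ← Matrix.mulVec_mulVec,
      ih fun j hj => hl j (by simp [hj]), eNeg_mulVec_col _ hp hi.1 hi.2]

theorem vecMul_col_prod_eNeg {m : ℕ} (l : List (ℕ × S)) {p : ℕ} (hp : p < m)
    (hl : ∀ i ∈ l, i.1 ≠ p ∧ i.1 ≠ p + 1) :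
    Matrix.vecMul (col S m p) ((l.map fun i => eNeg m i.1 i.2).prod) = col S m p := by
  induction l with
  | nil => simp
  | cons i l ih =>
    have hi := hl i (by simp)
    rw [List.map_cons, List.prod_cons, ← Matrix.vecMul_vecMul, vecMul_eNeg_col _ hp hi.1 hi.2,
      ih fun j hj => hl j (by simp [hj])]

end Action

/-! ### The transforming factors of an extended generalized Fiedler pencil -/

section Factors

variable {m n : ℕ} (D : Data m n)

theorem Data.nodup : (D.σ ++ D.ω).Nodup := D.perm.nodup_iff.2 List.nodup_range

theorem Data.not_mem_ω {i : ℕ} (h : i ∈ D.σ) : i ∉ D.ω :=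
  fun h' => List.disjoint_of_nodup_append D.nodup h h'

theorem Data.le {i : ℕ} (h : i ∈ D.σ ++ D.ω) : i ≤ m := by
  have := D.perm.mem_iff.1 h
  rw [List.mem_range] at this
  omega

theorem Data.σ_lt (hτ : m ∈ D.ω) {i : ℕ} (h : i ∈ D.σ) : i < m :=
  lt_of_le_of_ne (D.le (by simp [h])) fun e => D.not_mem_ω h (e ▸ hτ)

theorem Data.one_le_ω (hσ : 0 ∈ D.σ) {i : ℕ} (h : i ∈ D.ω) : 1 ≤ i :=
  Nat.one_le_iff_ne_zero.2 fun e => D.not_mem_ω hσ (e ▸ h)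

/-- The casts in the SIP fields of `Data` elaborate to a monadic coercion of the whole list, which
is rewritten here as a `map`. -/
theorem bind_pure_cast (l : List ℕ) :
    (do let a ← l; pure (a : ℤ)) = l.map fun i : ℕ => (i : ℤ) :=
  bind_pure_comp _ _

theorem Data.sip_σ_map : SIP ((D.σ₁ ++ D.σ ++ D.σ₂).map fun i : ℕ => (i : ℤ)) := by
  have := D.sip_σ
  rwa [bind_pure_cast, List.map_id'] at this

theorem Data.sip_τ_map : SIP ((D.ω₁ ++ D.ω ++ D.ω₂).map fun i : ℕ => -(i : ℤ)) := by
  have := D.sip_τ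
  rwa [bind_pure_cast, List.map_map] at this

/-- An index `q + 1` of `ω₁` or `ω₂` also occurs in `ω`. The SIP for `τ` would then put `-q` between
the two copies of `-(q + 1)`, so `q ∈ ω`, although `q ∈ σ`. -/
theorem Data.ne_succ {i q : ℕ} (hi : i ∈ D.ω₁ ++ D.ω₂) (hq : q ∈ D.σ) : i ≠ q + 1 := by
  rintro rfl
  have hω := (D.mem_τ _ hi).1
  obtain ⟨y₁, y₂, hy⟩ := List.append_of_mem hω
  have hsub : ∀ v : List ℕ, (∀ j ∈ v, j ∈ D.ω₁ ++ D.ω ++ D.ω₂) →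
      -((q + 1 : ℕ) : ℤ) + 1 ∉ v.map fun i : ℕ => -(i : ℤ) := by
    intro v hv h
    obtain ⟨j, hj, e⟩ := List.mem_map.1 h
    obtain rfl : j = q := by push_cast at e; omega
    have := hv j hj
    simp only [List.mem_append] at this
    refine D.not_mem_ω hq ?_
    rcases this with (h | h) | h
    · exact (D.mem_τ _ (List.mem_append_left _ h)).1
    · exact h
    · exact (D.mem_τ _ (List.mem_append_right _ h)).1
  rcases List.mem_append.1 hi with h | h <;> obtain ⟨x₁, x₂, hx⟩ := List.append_of_mem h
  · refine hsub (x₂ ++ y₁) (fun j hj => ?_) (D.sip_τ_map.mem_of_append (k := -((q + 1 : ℕ) : ℤ))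
      (u := x₁.map fun i : ℕ => -(i : ℤ)) (w := (y₂ ++ D.ω₂).map fun i : ℕ => -(i : ℤ)) ?_)
    · rw [hx, hy]
      simp only [List.mem_append, List.mem_cons] at hj ⊢
      tauto
    · rw [hx, hy]
      simp
  · refine hsub (y₂ ++ x₁) (fun j hj => ?_) (D.sip_τ_map.mem_of_append (k := -((q + 1 : ℕ) : ℤ))
      (u := (D.ω₁ ++ y₁).map fun i : ℕ => -(i : ℤ)) (w := x₂.map fun i : ℕ => -(i : ℤ)) ?_)
    · rw [hx, hy]
      simp only [List.mem_append, List.mem_cons] at hj ⊢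
      tauto
    · rw [hx, hy]
      simp

theorem Data.climbable_left {s₁ s₂ : List ℕ} (hs : D.σ = s₁ ++ 0 :: s₂) :
    Climbable 0 (D.σ₁ ++ s₁).reverse := by
  refine climbable_of_infix fun k u v w h => ?_
  have h' : D.σ₁ ++ s₁ ++ [0] = w.reverse ++ k :: v.reverse ++ k :: u.reverse := by
    have := congrArg List.reverse h
    simpa using this
  have := D.sip_σ_map.mem_of_append (k := (k : ℤ)) (u := w.reverse.map fun i : ℕ => (i : ℤ))
    (v := v.reverse.map fun i : ℕ => (i : ℤ))
    (w := (u.reverse ++ s₂ ++ D.σ₂).map fun i : ℕ => (i : ℤ)) (by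
      rw [hs, show D.σ₁ ++ (s₁ ++ 0 :: s₂) ++ D.σ₂ = (D.σ₁ ++ s₁ ++ [0]) ++ (s₂ ++ D.σ₂) by simp, h']
      simp)
  obtain ⟨j, hj, e⟩ := List.mem_map.1 this
  obtain rfl : j = k + 1 := by omega
  simpa using hj

theorem Data.climbable_right {s₁ s₂ : List ℕ} (hs : D.σ = s₁ ++ 0 :: s₂) :
    Climbable 0 (s₂ ++ D.σ₂) := by
  refine climbable_of_infix fun k u v w h => ?_
  have := D.sip_σ_map.mem_of_append (k := (k : ℤ)) (u := (D.σ₁ ++ s₁ ++ u).map fun i : ℕ => (i : ℤ))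
    (v := v.map fun i : ℕ => (i : ℤ)) (w := w.map fun i : ℕ => (i : ℤ)) (by
      rw [hs, show D.σ₁ ++ (s₁ ++ 0 :: s₂) ++ D.σ₂ = (D.σ₁ ++ s₁) ++ (0 :: (s₂ ++ D.σ₂)) by simp, h]
      simp)
  obtain ⟨j, hj, e⟩ := List.mem_map.1 this
  obtain rfl : j = k + 1 := by omega
  exact hj

/-- A chain of inversions ends in `0`, so nothing after the last `0`, the one in `σ`, contributes.
-/
theorem Data.inversions_eq {s₁ s₂ : List ℕ} (hs : D.σ = s₁ ++ 0 :: s₂) :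
    inversions 0 (D.σ₁ ++ D.σ) = climb 0 (D.σ₁ ++ s₁).reverse := by
  have h0 : 0 ∉ s₂.reverse := by
    have := (List.nodup_append.1 D.nodup).1
    rw [hs] at this
    simpa using (List.nodup_cons.1 (List.nodup_append.1 this).2.1).1
  rw [inversions_eq_consecutions_reverse, ← consecutions_append_cons h0, hs]
  simp

theorem Data.consecutions_eq {s₁ s₂ : List ℕ} (hs : D.σ = s₁ ++ 0 :: s₂) :
    consecutions 0 (D.σ ++ D.σ₂) = climb 0 (s₂ ++ D.σ₂) := by
  have h0 : 0 ∉ s₁ := by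
    have := (List.nodup_append.1 D.nodup).1
    rw [hs] at this
    exact fun h => (List.nodup_append.1 this).2.2 0 h 0 (by simp) rfl
  rw [← consecutions_append_cons h0, hs]
  simp

theorem Data.climb_left_mem {s₁ s₂ : List ℕ} (hs : D.σ = s₁ ++ 0 :: s₂) :
    climb 0 (D.σ₁ ++ s₁).reverse ∈ D.σ := by
  rcases climb_mem 0 (D.σ₁ ++ s₁).reverse with h | h
  · rw [h, hs]
    simp
  · rw [List.mem_reverse, List.mem_append] at h
    rcases h with h | h
    · exact (D.mem_σ _ (List.mem_append_left _ h)).1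
    · generalize climb 0 _ = q at h
      rw [hs]
      simp [h]

theorem Data.climb_right_mem {s₁ s₂ : List ℕ} (hs : D.σ = s₁ ++ 0 :: s₂) :
    climb 0 (s₂ ++ D.σ₂) ∈ D.σ := by
  rcases climb_mem 0 (s₂ ++ D.σ₂) with h | h
  · rw [h, hs]
    simp
  · rw [List.mem_append] at h
    rcases h with h | h
    · generalize climb 0 _ = q at h
      rw [hs]
      simp [h]
    · exact (D.mem_σ _ (List.mem_append_right _ h)).1

variable {S : Type*} [Ring S] (f : Matrix (Fin n) (Fin n) ℂ →+* S)

/-- The matrix `M_{τ₁}(Y₁) M_{σ₁}(X₁)` over a ring to which `ℂ^{n × n}` is mapped. -/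
def Data.leftFactor : Matrix (Fin m) (Fin m) S :=
  ((D.ω₁.zip D.Y₁).map fun i => eNeg m i.1 (f i.2)).prod *
    ((D.σ₁.zip D.X₁).map fun i => ePos m i.1 (f i.2)).prod

/-- The matrix `M_{σ₂}(X₂) M_{τ₂}(Y₂)` over a ring to which `ℂ^{n × n}` is mapped. -/
def Data.rightFactor : Matrix (Fin m) (Fin m) S :=
  ((D.σ₂.zip D.X₂).map fun i => ePos m i.1 (f i.2)).prod *
    ((D.ω₂.zip D.Y₂).map fun i => eNeg m i.1 (f i.2)).prod

theorem isUnit_list_prod {M : Type*} [Monoid M] {l : List M} (h : ∀ x ∈ l, IsUnit x) :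
    IsUnit l.prod := by
  induction l with
  | nil => simp
  | cons x l ih =>
    rw [List.prod_cons]
    exact (h x (by simp)).mul (ih fun y hy => h y (by simp [hy]))

theorem isUnit_prod_ePos {t : List ℕ} {X : List (Matrix (Fin n) (Fin n) ℂ)}
    (h : IsNonsingularAssignment m t X) (ht : ∀ i ∈ t, i < m) :
    IsUnit ((t.zip X).map fun i => ePos m i.1 (f i.2)).prod := by
  refine isUnit_list_prod fun M hM => ?_
  obtain ⟨i, hi, rfl⟩ := List.mem_map.1 hM
  exact isUnit_ePos (ht _ (List.of_mem_zip (show (i.1, i.2) ∈ _ from hi)).1) fun h0 =>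
    ((Matrix.isUnit_iff_isUnit_det _).2 (h.2 i hi (.inl h0))).map f

theorem isUnit_prod_eNeg {t : List ℕ} {X : List (Matrix (Fin n) (Fin n) ℂ)}
    (h : IsNonsingularAssignment m t X) (ht : ∀ i ∈ t, 1 ≤ i ∧ i ≤ m) :
    IsUnit ((t.zip X).map fun i => eNeg m i.1 (f i.2)).prod := by
  refine isUnit_list_prod fun M hM => ?_
  obtain ⟨i, hi, rfl⟩ := List.mem_map.1 hM
  have := ht _ (List.of_mem_zip (show (i.1, i.2) ∈ _ from hi)).1
  exact isUnit_eNeg this.2 this.1 fun h0 =>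
    ((Matrix.isUnit_iff_isUnit_det _).2 (h.2 i hi (.inr h0))).map f

theorem Data.isUnit_leftFactor (hσ : 0 ∈ D.σ) (hτ : m ∈ D.ω) : IsUnit (D.leftFactor f) := by
  refine (isUnit_prod_eNeg f D.nonsing_Y₁ fun i hi => ?_).mul
    (isUnit_prod_ePos f D.nonsing_X₁ fun i hi => ?_)
  · have := (D.mem_τ i (List.mem_append_left _ hi)).1
    exact ⟨D.one_le_ω hσ this, D.le (List.mem_append_right _ this)⟩
  · exact D.σ_lt hτ (D.mem_σ i (List.mem_append_left _ hi)).1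

theorem Data.isUnit_rightFactor (hσ : 0 ∈ D.σ) (hτ : m ∈ D.ω) : IsUnit (D.rightFactor f) := by
  refine (isUnit_prod_ePos f D.nonsing_X₂ fun i hi => ?_).mul
    (isUnit_prod_eNeg f D.nonsing_Y₂ fun i hi => ?_)
  · exact D.σ_lt hτ (D.mem_σ i (List.mem_append_right _ hi)).1
  · have := (D.mem_τ i (List.mem_append_right _ hi)).1
    exact ⟨D.one_le_ω hσ this, D.le (List.mem_append_right _ this)⟩

theorem map_fst_zip_map {α β γ : Type*} (g : β → γ) (t : List α) (X : List β)
    (h : X.length = t.length) : ((t.zip X).map fun i => (i.1, g i.2)).map Prod.fst = t := by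
  rw [List.map_map]
  exact List.map_fst_zip h.ge

/-- The origin of the position `m - i_0(σ₁, σ)`: the vector climbs along `s₁` and then `σ₁`. The
endpoint `q` lies in `σ`, so neither `q` nor `q + 1` is an index of `ω₁`, and `M_{τ₁}` fixes it. -/
theorem Data.leftFactor_mulVec (hτ : m ∈ D.ω) {s₁ s₂ : List ℕ}
    (hs : D.σ = s₁ ++ 0 :: s₂) (a : ℕ → S) :
    (D.leftFactor f * fPos m a s₁).mulVec (col S m 0) =
      col S m (climb 0 (D.σ₁ ++ s₁).reverse) := by
  set l : List (ℕ × S) := (D.σ₁.zip D.X₁).map (fun i => (i.1, f i.2)) ++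
    s₁.map fun i => (i, -a i) with hl
  have hfst : l.map Prod.fst = D.σ₁ ++ s₁ := by
    rw [hl, List.map_append, map_fst_zip_map f _ _ D.nonsing_X₁.1, List.map_map]
    simp [Function.comp_def]
  have hmem : ∀ i ∈ l, i.1 < m := by
    intro i hi
    have : i.1 ∈ D.σ₁ ++ s₁ := hfst ▸ List.mem_map_of_mem hi
    rcases List.mem_append.1 this with h | h
    · exact D.σ_lt hτ (D.mem_σ _ (List.mem_append_left _ h)).1
    · exact D.σ_lt hτ (by rw [hs]; simp [h])
  have hq := D.climb_left_mem hs
  have hm := D.σ_lt hτ (D.climb_left_mem hs)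
  have h1 := prod_ePos_mulVec_col l hmem (p := 0) (by omega) (by
    rw [hfst]; exact D.climbable_left hs)
  rw [hfst] at h1
  have e : D.leftFactor f * fPos m a s₁ =
      (((D.ω₁.zip D.Y₁).map fun i => (i.1, f i.2)).map fun i => eNeg m i.1 i.2).prod *
        (l.map fun i => ePos m i.1 i.2).prod := by
    rw [hl, Data.leftFactor, fPos, List.map_append, List.prod_append, mul_assoc]
    simp only [List.map_map, Function.comp_def]
  rw [e, ← Matrix.mulVec_mulVec, h1]
  refine prod_eNeg_mulVec_col _ hm fun i hi => ?_
  have : i.1 ∈ D.ω₁ := (map_fst_zip_map f _ _ D.nonsing_Y₁.1) ▸ List.mem_map_of_mem hi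
  exact ⟨fun e => D.not_mem_ω hq (e ▸ (D.mem_τ _ (List.mem_append_left _ this)).1),
    D.ne_succ (List.mem_append_left _ this) hq⟩

theorem Data.vecMul_rightFactor (hτ : m ∈ D.ω) {s₁ s₂ : List ℕ}
    (hs : D.σ = s₁ ++ 0 :: s₂) (a : ℕ → S) :
    Matrix.vecMul (col S m 0) (fPos m a s₂ * D.rightFactor f) =
      col S m (climb 0 (s₂ ++ D.σ₂)) := by
  set l : List (ℕ × S) := (s₂.map fun i => (i, -a i)) ++
    (D.σ₂.zip D.X₂).map (fun i => (i.1, f i.2)) with hl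
  have hfst : l.map Prod.fst = s₂ ++ D.σ₂ := by
    rw [hl, List.map_append, map_fst_zip_map f _ _ D.nonsing_X₂.1, List.map_map]
    simp [Function.comp_def]
  have hmem : ∀ i ∈ l, i.1 < m := by
    intro i hi
    have : i.1 ∈ s₂ ++ D.σ₂ := hfst ▸ List.mem_map_of_mem hi
    rcases List.mem_append.1 this with h | h
    · exact D.σ_lt hτ (by rw [hs]; simp [h])
    · exact D.σ_lt hτ (D.mem_σ _ (List.mem_append_right _ h)).1
  have hq := D.climb_right_mem hs
  have hm := D.σ_lt hτ (D.climb_right_mem hs)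
  have h1 := vecMul_col_prod_ePos l hmem (p := 0) (by omega) (by
    rw [hfst]; exact D.climbable_right hs)
  rw [hfst] at h1
  have e : fPos m a s₂ * D.rightFactor f = (l.map fun i => ePos m i.1 i.2).prod *
      (((D.ω₂.zip D.Y₂).map fun i => (i.1, f i.2)).map fun i => eNeg m i.1 i.2).prod := by
    rw [hl, Data.rightFactor, fPos, List.map_append, List.prod_append, ← mul_assoc]
    simp only [List.map_map, Function.comp_def]
  rw [e, ← Matrix.vecMul_vecMul, h1]
  refine vecMul_col_prod_eNeg _ hm fun i hi => ?_
  have : i.1 ∈ D.ω₂ := (map_fst_zip_map f _ _ D.nonsing_Y₂.1) ▸ List.mem_map_of_mem hi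
  exact ⟨fun e => D.not_mem_ω hq (e ▸ (D.mem_τ _ (List.mem_append_right _ this)).1),
    D.ne_succ (List.mem_append_right _ this) hq⟩

end Factors

/-! ### Rational functions with a finite limit at infinity -/

section Proper

open Filter Topology

/-- `f(λ) → c` as `λ → ∞`. -/
def HasLimitAtInfty (f : RatFunc ℂ) (c : ℂ) : Prop :=
  Tendsto (fun z : ℂ => f.eval (RingHom.id ℂ) z) (cocompact ℂ) (𝓝 c)

/-- Evaluation of rational functions respects sums and products only away from zeros of the
denominators; these are finitely many and hence irrelevant near infinity. -/
theorem eventually_eval_ne_zero {p : Polynomial ℂ} (hp : p ≠ 0) :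
    ∀ᶠ z in cocompact ℂ, p.eval₂ (RingHom.id ℂ) z ≠ 0 := by
  have hfin : {z : ℂ | p.IsRoot z}.Finite := p.finite_setOfPred_isRoot hp
  filter_upwards [hfin.isCompact.compl_mem_cocompact] with z hz
  simpa using hz

theorem hasLimitAtInfty_unique {f : RatFunc ℂ} {c d : ℂ} (hc : HasLimitAtInfty f c)
    (hd : HasLimitAtInfty f d) : c = d := tendsto_nhds_unique hc hd

theorem HasLimitAtInfty.add {f g : RatFunc ℂ} {c d : ℂ} (hf : HasLimitAtInfty f c)
    (hg : HasLimitAtInfty g d) : HasLimitAtInfty (f + g) (c + d) := by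
  refine (Tendsto.add hf hg).congr' ?_
  filter_upwards [eventually_eval_ne_zero f.denom_ne_zero,
    eventually_eval_ne_zero g.denom_ne_zero] with z h1 h2
  exact (RatFunc.eval_add (RingHom.id ℂ) z h1 h2).symm

theorem HasLimitAtInfty.mul {f g : RatFunc ℂ} {c d : ℂ} (hf : HasLimitAtInfty f c)
    (hg : HasLimitAtInfty g d) : HasLimitAtInfty (f * g) (c * d) := by
  refine (Tendsto.mul hf hg).congr' ?_
  filter_upwards [eventually_eval_ne_zero f.denom_ne_zero,
    eventually_eval_ne_zero g.denom_ne_zero] with z h1 h2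
  exact (RatFunc.eval_mul (RingHom.id ℂ) z h1 h2).symm

theorem hasLimitAtInfty_C (c : ℂ) : HasLimitAtInfty (RatFunc.C c) c := by
  simp [HasLimitAtInfty]

theorem HasLimitAtInfty.inv {f : RatFunc ℂ} {c : ℂ} (hf : HasLimitAtInfty f c) (hc : c ≠ 0) :
    HasLimitAtInfty f⁻¹ c⁻¹ := by
  have hf0 : f ≠ 0 := by
    rintro rfl
    refine hc (hasLimitAtInfty_unique hf ?_)
    simpa using hasLimitAtInfty_C 0
  refine (Tendsto.inv₀ hf hc).congr' ?_
  filter_upwards [eventually_eval_ne_zero f.denom_ne_zero,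
    eventually_eval_ne_zero f⁻¹.denom_ne_zero] with z h1 h2
  have := RatFunc.eval_mul (RingHom.id ℂ) z h1 h2
  rw [mul_inv_cancel₀ hf0, RatFunc.eval_one] at this
  exact inv_eq_of_mul_eq_one_right this.symm

theorem hasLimitAtInfty_X_inv : HasLimitAtInfty (RatFunc.X : RatFunc ℂ)⁻¹ 0 := by
  refine (tendsto_inv₀_cobounded (α := ℂ)).congr' ?_ |>.mono_left (by rw [Metric.cobounded_eq_cocompact])
  rw [Metric.cobounded_eq_cocompact]
  filter_upwards [eventually_eval_ne_zero (RatFunc.X : RatFunc ℂ).denom_ne_zero,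
    eventually_eval_ne_zero (RatFunc.X : RatFunc ℂ)⁻¹.denom_ne_zero] with z h1 h2
  have := RatFunc.eval_mul (RingHom.id ℂ) z h1 h2
  rw [mul_inv_cancel₀ RatFunc.X_ne_zero, RatFunc.eval_one, RatFunc.eval_X] at this
  exact inv_eq_of_mul_eq_one_right this.symm

/-- The ring of proper rational functions. -/
def properRing : Subring (RatFunc ℂ) where
  carrier := {f | ∃ c, HasLimitAtInfty f c}
  mul_mem' := fun ⟨_, hf⟩ ⟨_, hg⟩ => ⟨_, hf.mul hg⟩
  one_mem' := ⟨1, by simpa using hasLimitAtInfty_C 1⟩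
  add_mem' := fun ⟨_, hf⟩ ⟨_, hg⟩ => ⟨_, hf.add hg⟩
  zero_mem' := ⟨0, by simpa using hasLimitAtInfty_C 0⟩
  neg_mem' := fun {f} ⟨c, hf⟩ => ⟨-1 * c, by
    have := (hasLimitAtInfty_C (-1)).mul hf
    simpa using this⟩

/-- The value at infinity of a proper rational function. -/
noncomputable def valueAtInfty : properRing →+* ℂ where
  toFun f := f.2.choose
  map_one' := hasLimitAtInfty_unique (1 : properRing).2.choose_spec
    (by simpa using hasLimitAtInfty_C 1)
  map_mul' f g := hasLimitAtInfty_unique (f * g).2.choose_spec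
    (f.2.choose_spec.mul g.2.choose_spec)
  map_zero' := hasLimitAtInfty_unique (0 : properRing).2.choose_spec
    (by simpa using hasLimitAtInfty_C 0)
  map_add' f g := hasLimitAtInfty_unique (f + g).2.choose_spec
    (f.2.choose_spec.add g.2.choose_spec)

theorem hasLimitAtInfty_valueAtInfty (f : properRing) :
    HasLimitAtInfty (f : RatFunc ℂ) (valueAtInfty f) := f.2.choose_spec

theorem valueAtInfty_eq {f : properRing} {c : ℂ} (h : HasLimitAtInfty (f : RatFunc ℂ) c) :
    valueAtInfty f = c := hasLimitAtInfty_unique (hasLimitAtInfty_valueAtInfty f) h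

theorem isUnit_of_valueAtInfty_ne_zero {f : properRing} (h : valueAtInfty f ≠ 0) : IsUnit f := by
  have hf := hasLimitAtInfty_valueAtInfty f
  have hf0 : (f : RatFunc ℂ) ≠ 0 := by
    intro e
    refine h ?_
    rw [show f = 0 from Subtype.ext e, map_zero]
  refine IsUnit.of_mul_eq_one ⟨(f : RatFunc ℂ)⁻¹, _, hf.inv h⟩ (Subtype.ext ?_)
  exact mul_inv_cancel₀ hf0

/-- The constants, as proper rational functions. -/
noncomputable def properC : ℂ →+* properRing :=
  (RatFunc.C : ℂ →+* RatFunc ℂ).codRestrict properRing fun c => ⟨c, hasLimitAtInfty_C c⟩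

/-- The proper rational function `λ⁻¹`. -/
noncomputable def properXInv : properRing := ⟨(RatFunc.X : RatFunc ℂ)⁻¹, 0, hasLimitAtInfty_X_inv⟩

/-- The value at infinity is a ring homomorphism, so it sends an invertible matrix to an invertible
matrix of limits. -/
theorem isBiproper_of_isUnit {ν : Type} [Fintype ν] [DecidableEq ν] {M : Matrix ν ν properRing}
    (h : IsUnit M) : IsBiproper (properRing.subtype.mapMatrix M) := by
  refine ⟨valueAtInfty.mapMatrix M, (Matrix.isUnit_iff_isUnit_det _).1 (h.map _), fun i j => ?_⟩
  exact hasLimitAtInfty_valueAtInfty (M i j)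

end Proper

/-! ### Block matrices over a commutative ring as matrices over a matrix ring -/

section Blocks

open Matrix

variable {m n : ℕ} {κ : Type*} [Fintype κ] {R : Type*} [CommRing R]

/-- The matrix `u * N` for a block column `u` of square blocks. -/
def liftCol (u : Fin m → Matrix (Fin n) (Fin n) R) (N : Matrix (Fin n) κ R) :
    Matrix (Fin m × Fin n) κ R :=
  Matrix.of fun p j => (u p.1 * N) p.2 j

/-- The matrix `N * v` for a block row `v` of square blocks. -/
def liftRow (N : Matrix κ (Fin n) R) (v : Fin m → Matrix (Fin n) (Fin n) R) :
    Matrix κ (Fin m × Fin n) R :=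
  Matrix.of fun i q => (N * v q.1) i q.2

/-- The matrix `u g v` for a column `u` and a row `v`. -/
def outer {S : Type*} [Ring S] (u : Fin m → S) (g : S) (v : Fin m → S) : Matrix (Fin m) (Fin m) S :=
  Matrix.of fun p q => u p * g * v q

theorem mul_outer_mul {S : Type*} [Ring S] (Z W : Matrix (Fin m) (Fin m) S) (u v : Fin m → S)
    (g : S) : Z * outer u g v * W = outer (Z.mulVec u) g (Matrix.vecMul v W) := by
  ext p q
  simp only [outer, mul_apply, of_apply, mulVec, vecMul, dotProduct, Finset.sum_mul,
    Finset.mul_sum, mul_assoc]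

/-- Read with `x = -A_0`, this says that adding `g` to `A_0` changes `M_0` by `e_m g e_mᵀ`. -/
theorem dLast_sub {S : Type*} [Ring S] (x g : S) :
    dLast m (x - g) = dLast m x - outer (col S m 0) g (col S m 0) := by
  ext p q
  simp only [dLast, outer, col, of_apply, Matrix.sub_apply, add_zero]
  split_ifs <;> simp_all

omit [Fintype κ] in
theorem comp_mul_liftCol (Z : Matrix (Fin m) (Fin m) (Matrix (Fin n) (Fin n) R))
    (u : Fin m → Matrix (Fin n) (Fin n) R) (N : Matrix (Fin n) κ R) :
    compRingEquiv (Fin m) (Fin n) R Z * liftCol u N = liftCol (Z.mulVec u) N := by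
  ext p j
  simp only [liftCol, of_apply, mulVec, dotProduct, Matrix.sum_mul, Matrix.sum_apply,
    mul_apply (M := compRingEquiv (Fin m) (Fin n) R Z), Fintype.sum_prod_type]
  exact Finset.sum_congr rfl fun q _ => by
    rw [Matrix.mul_assoc, Matrix.mul_apply]
    rfl

omit [Fintype κ] in
theorem liftRow_mul_comp (Z : Matrix (Fin m) (Fin m) (Matrix (Fin n) (Fin n) R))
    (v : Fin m → Matrix (Fin n) (Fin n) R) (N : Matrix κ (Fin n) R) :
    liftRow N v * compRingEquiv (Fin m) (Fin n) R Z = liftRow N (Matrix.vecMul v Z) := by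
  ext i q
  simp only [liftRow, of_apply, vecMul, dotProduct, Matrix.mul_sum, Matrix.sum_apply,
    mul_apply (N := compRingEquiv (Fin m) (Fin n) R Z), Fintype.sum_prod_type]
  exact Finset.sum_congr rfl fun q _ => by
    rw [← Matrix.mul_assoc, Matrix.mul_apply]
    rfl

/-- The state dimension is contracted, so the coupling term becomes an `m × m` matrix over the block
ring. -/
theorem liftCol_mul_mul_liftRow (u v : Fin m → Matrix (Fin n) (Fin n) R)
    (N : Matrix (Fin n) κ R) (M : Matrix κ κ R) (N' : Matrix κ (Fin n) R) :
    liftCol u N * M * liftRow N' v = compRingEquiv (Fin m) (Fin n) R (outer u (N * M * N') v) := by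
  have h : liftCol u N * M = liftCol u (N * M) := by
    ext p j
    simp only [liftCol, of_apply, ← Matrix.mul_assoc]
    rw [mul_apply, mul_apply]
    rfl
  rw [h]
  ext p q
  change _ = (u p.1 * (N * M * N') * v q.1) p.2 q.2
  rw [Matrix.mul_assoc, Matrix.mul_assoc (N * M), ← Matrix.mul_assoc (u p.1), mul_apply, mul_apply]
  rfl

theorem blockCol_map {r : ℕ} (f : ℂ →+* R) (q : ℕ) (C : Matrix (Fin n) (Fin r) ℂ) :
    (blockCol m ((m : ℤ) - q) C).map f = liftCol (col _ m q) (C.map f) := by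
  ext p j
  simp only [blockCol, liftCol, col, map_apply, of_apply]
  simp only [show ((p.1 : ℕ) : ℤ) + 1 = m - q ↔ p.1.1 + 1 + q = m by omega]
  split_ifs <;> simp

theorem blockRow_map {r : ℕ} (f : ℂ →+* R) (q : ℕ) (B : Matrix (Fin r) (Fin n) ℂ) :
    (blockRow m ((m : ℤ) - q) B).map f = liftRow (B.map f) (col _ m q) := by
  ext p j
  simp only [blockRow, liftRow, col, map_apply, of_apply]
  simp only [show ((j.1 : ℕ) : ℤ) + 1 = m - q ↔ j.1.1 + 1 + q = m by omega]
  split_ifs <;> simp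

theorem comp_dLast {R : Type} [CommRing R] (Q : Matrix (Fin n) (Fin n) R) :
    compRingEquiv (Fin m) (Fin n) R (dLast m Q) = diagLast m Q := by
  ext ⟨p, a⟩ ⟨q, b⟩
  simp only [compRingEquiv_apply, comp_apply, dLast, diagLast, of_apply]
  split_ifs <;> simp_all [one_apply]

theorem comp_mapMatrix {R' : Type*} [CommRing R'] (g : R →+* R')
    (Z : Matrix (Fin m) (Fin m) (Matrix (Fin n) (Fin n) R)) :
    compRingEquiv (Fin m) (Fin n) R' (g.mapMatrix.mapMatrix Z) =
      g.mapMatrix (compRingEquiv (Fin m) (Fin n) R Z) := rfl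

theorem comp_smul (t : R) (Z : Matrix (Fin m) (Fin m) (Matrix (Fin n) (Fin n) R)) :
    compRingEquiv (Fin m) (Fin n) R (t • Z) = t • compRingEquiv (Fin m) (Fin n) R Z := rfl

theorem mapMatrix_mapMatrix_smul {R' : Type*} [CommRing R'] (g : R →+* R') (t : R)
    (Z : Matrix (Fin m) (Fin m) (Matrix (Fin n) (Fin n) R)) :
    g.mapMatrix.mapMatrix (t • Z) = g t • g.mapMatrix.mapMatrix Z := by
  ext p q a b
  simp

theorem mapMatrix_elemPos (f : ℂ →+* R) (i : ℕ) (X : Matrix (Fin n) (Fin n) ℂ) :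
    f.mapMatrix (elemPos m i X) = compRingEquiv (Fin m) (Fin n) R (ePos m i (f.mapMatrix X)) := by
  ext ⟨p, a⟩ ⟨q, b⟩
  simp only [RingHom.mapMatrix_apply, map_apply, compRingEquiv_apply, comp_apply, elemPos, ePos,
    of_apply, Fin.ext_iff]
  split_ifs <;> simp [one_apply, apply_ite f]

theorem mapMatrix_elemNeg (f : ℂ →+* R) (i : ℕ) (X : Matrix (Fin n) (Fin n) ℂ) :
    f.mapMatrix (elemNeg m i X) = compRingEquiv (Fin m) (Fin n) R (eNeg m i (f.mapMatrix X)) := by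
  ext ⟨p, a⟩ ⟨q, b⟩
  simp only [RingHom.mapMatrix_apply, map_apply, compRingEquiv_apply, comp_apply, elemNeg, eNeg,
    of_apply, Fin.ext_iff]
  split_ifs <;> simp [one_apply, apply_ite f]

theorem mapMatrix_prodPos (f : ℂ →+* R) (t : List ℕ) (X : List (Matrix (Fin n) (Fin n) ℂ)) :
    f.mapMatrix (prodPos m t X) = compRingEquiv (Fin m) (Fin n) R
      ((t.zip X).map fun i => ePos m i.1 (f.mapMatrix i.2)).prod := by
  rw [prodPos, ← List.map_uncurry_zip_eq_zipWith, map_list_prod, map_list_prod, List.map_map,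
    List.map_map]
  congr 2
  ext1 i
  exact mapMatrix_elemPos f i.1 i.2

theorem mapMatrix_prodNeg (f : ℂ →+* R) (t : List ℕ) (X : List (Matrix (Fin n) (Fin n) ℂ)) :
    f.mapMatrix (prodNeg m t X) = compRingEquiv (Fin m) (Fin n) R
      ((t.zip X).map fun i => eNeg m i.1 (f.mapMatrix i.2)).prod := by
  rw [prodNeg, ← List.map_uncurry_zip_eq_zipWith, map_list_prod, map_list_prod, List.map_map,
    List.map_map]
  congr 2
  ext1 i
  exact mapMatrix_elemNeg f i.1 i.2

/-- The condition `m ∉ σ` avoids the factor defined by an inverse; `0 ∉ ω` does so in the negative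
case. -/
theorem mapMatrix_prod_fiedlerPos (f : ℂ →+* R) (A : ℕ → Matrix (Fin n) (Fin n) ℂ) {σ : List ℕ}
    (h : m ∉ σ) : f.mapMatrix (σ.map (fiedlerPos m A)).prod =
      compRingEquiv (Fin m) (Fin n) R (fPos m (fun j => f.mapMatrix (A j)) σ) := by
  rw [fPos, map_list_prod, map_list_prod, List.map_map, List.map_map]
  refine congrArg List.prod (List.map_congr_left fun i hi => ?_)
  have : i ≠ m := fun e => h (e ▸ hi)
  simp only [Function.comp_apply, fiedlerPos, if_neg this, mapMatrix_elemPos, map_neg]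

theorem mapMatrix_prod_fiedlerNeg (f : ℂ →+* R) (A : ℕ → Matrix (Fin n) (Fin n) ℂ) {ω : List ℕ}
    (h : 0 ∉ ω) : f.mapMatrix (ω.map (fiedlerNeg m A)).prod =
      compRingEquiv (Fin m) (Fin n) R (fNeg m (fun j => f.mapMatrix (A j)) ω) := by
  rw [fNeg, map_list_prod, map_list_prod, List.map_map, List.map_map]
  refine congrArg List.prod (List.map_congr_left fun i hi => ?_)
  have : i ≠ 0 := fun e => h (e ▸ hi)
  simp only [Function.comp_apply, fiedlerNeg, if_neg this, mapMatrix_elemNeg]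

section
variable {S S' : Type*} [Ring S] [Ring S'] (g : S →+* S')

theorem mapMatrix_ePos (i : ℕ) (x : S) : g.mapMatrix (ePos m i x) = ePos m i (g x) := by
  ext p q
  simp only [ePos, RingHom.mapMatrix_apply, map_apply, of_apply, apply_ite g, map_one, map_zero]

theorem mapMatrix_eNeg (i : ℕ) (x : S) : g.mapMatrix (eNeg m i x) = eNeg m i (g x) := by
  ext p q
  simp only [eNeg, RingHom.mapMatrix_apply, map_apply, of_apply, apply_ite g, map_one, map_zero]

theorem mapMatrix_fPos (a : ℕ → S) (σ : List ℕ) :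
    g.mapMatrix (fPos m a σ) = fPos m (fun j => g (a j)) σ := by
  rw [fPos, map_list_prod, fPos, List.map_map]
  congr 2
  ext1 i
  simp only [Function.comp_apply, mapMatrix_ePos, map_neg]

theorem mapMatrix_fNeg (a : ℕ → S) (σ : List ℕ) :
    g.mapMatrix (fNeg m a σ) = fNeg m (fun j => g (a j)) σ := by
  rw [fNeg, map_list_prod, fNeg, List.map_map]
  congr 2
  ext1 i
  simp only [Function.comp_apply, mapMatrix_eNeg]

theorem mapMatrix_leftFactor (D : Data m n) (f : Matrix (Fin n) (Fin n) ℂ →+* S) :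
    g.mapMatrix (D.leftFactor f) = D.leftFactor (g.comp f) := by
  simp only [Data.leftFactor, map_mul, map_list_prod, List.map_map, Function.comp_def,
    mapMatrix_ePos, mapMatrix_eNeg, RingHom.comp_apply]

theorem mapMatrix_rightFactor (D : Data m n) (f : Matrix (Fin n) (Fin n) ℂ →+* S) :
    g.mapMatrix (D.rightFactor f) = D.rightFactor (g.comp f) := by
  simp only [Data.rightFactor, map_mul, map_list_prod, List.map_map, Function.comp_def,
    mapMatrix_ePos, mapMatrix_eNeg, RingHom.comp_apply]

theorem fPos_congr {a b : ℕ → S} {σ : List ℕ} (h : ∀ i ∈ σ, a i = b i) :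
    fPos m a σ = fPos m b σ :=
  congrArg List.prod (List.map_congr_left fun i hi => by rw [h i hi])

theorem fNeg_congr {a b : ℕ → S} {σ : List ℕ} (h : ∀ i ∈ σ, a i = b i) :
    fNeg m a σ = fNeg m b σ :=
  congrArg List.prod (List.map_congr_left fun i hi => by rw [h i hi])

end

end Blocks

open Matrix

/-! ### Unimodular equivalence, irreducibility, and the proper part of the realization -/

section Linearization

variable {m n r : ℕ} (D : Data m n) (coef : ℕ → Matrix (Fin n) (Fin n) ℂ)

theorem Data.egfp_eq (hσ : 0 ∈ D.σ) (hτ : m ∈ D.ω) :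
    D.egfp coef = compRingEquiv (Fin m) (Fin n) (Polynomial ℂ)
      (D.leftFactor Polynomial.C.mapMatrix *
        ((Polynomial.X : Polynomial ℂ) • fNeg m (fun j => Polynomial.C.mapMatrix (coef j)) D.ω -
          fPos m (fun j => Polynomial.C.mapMatrix (coef j)) D.σ) *
        D.rightFactor Polynomial.C.mapMatrix) := by
  have e : ∀ M : Matrix (Fin m × Fin n) (Fin m × Fin n) ℂ,
    constPoly M = Polynomial.C.mapMatrix M := fun _ => rfl
  simp only [Data.egfp, e, mapMatrix_prodPos, mapMatrix_prodNeg,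
    mapMatrix_prod_fiedlerPos Polynomial.C coef (fun h => D.not_mem_ω h hτ),
    mapMatrix_prod_fiedlerNeg Polynomial.C coef (D.not_mem_ω hσ), Data.leftFactor,
    Data.rightFactor, map_mul, map_sub, comp_smul, mul_assoc]

noncomputable section

/-- The constant coefficient of an extended generalized Fiedler pencil. -/
def Data.constCoeff : Matrix (Fin m × Fin n) (Fin m × Fin n) ℂ :=
  -(prodNeg m D.ω₁ D.Y₁ * prodPos m D.σ₁ D.X₁ * (D.σ.map (fiedlerPos m coef)).prod *
    prodPos m D.σ₂ D.X₂ * prodNeg m D.ω₂ D.Y₂)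

/-- The negative of the leading coefficient of an extended generalized Fiedler pencil. -/
def Data.negLeadingCoeff : Matrix (Fin m × Fin n) (Fin m × Fin n) ℂ :=
  -(prodNeg m D.ω₁ D.Y₁ * prodPos m D.σ₁ D.X₁ * (D.ω.map (fiedlerNeg m coef)).prod *
    prodPos m D.σ₂ D.X₂ * prodNeg m D.ω₂ D.Y₂)

end

theorem Data.pencil_eq_egfp :
    pencil (D.constCoeff coef) (D.negLeadingCoeff coef) = D.egfp coef := by
  have e : ∀ M : Matrix (Fin m × Fin n) (Fin m × Fin n) ℂ,
    constPoly M = Polynomial.C.mapMatrix M := fun _ => rfl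
  simp only [pencil, Data.egfp, Data.constCoeff, Data.negLeadingCoeff, e, map_neg, map_mul,
    mul_sub, sub_mul, smul_mul_assoc, mul_smul_comm, smul_neg]
  abel

variable (C : Matrix (Fin n) (Fin r) ℂ) (B : Matrix (Fin r) (Fin n) ℂ)
  (A E : Matrix (Fin r) (Fin r) ℂ)

theorem exists_isUnit_inverse {M : Type*} [Monoid M] {x : M} (h : IsUnit x) :
    ∃ y, IsUnit y ∧ y * x = 1 ∧ x * y = 1 := by
  obtain ⟨u, rfl⟩ := h
  exact ⟨↑u⁻¹, Units.isUnit _, u.inv_mul, u.mul_inv⟩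

theorem mul_cancel_factors {M : Type*} [Monoid M] {x y x' y' : M} (hx : x' * x = 1)
    (hy : y * y' = 1) (u z v : M) : u * x' * (x * z * y) * (y' * v) = u * z * v := by
  calc _ = u * (x' * x) * z * (y * y') * v := by simp only [mul_assoc]
    _ = _ := by rw [hx, hy, mul_one, mul_one]

theorem isUnimodular_of_isUnit {ν : Type} [Fintype ν] [DecidableEq ν]
    {U : Matrix ν ν (Polynomial ℂ)} (h : IsUnit U) : IsUnimodular U := by
  obtain ⟨c, hc, h⟩ := Polynomial.isUnit_iff.1 ((Matrix.isUnit_iff_isUnit_det U).1 h)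
  exact ⟨c, hc.ne_zero, h.symm⟩

/-- The unimodular equivalence of the bordered pencil with the system matrix. -/
theorem Data.exists_unimodular (hσ : 0 ∈ D.σ) (hτ : m ∈ D.ω) :
    ∃ (U V : Matrix (Fin m × Fin n) (Fin m × Fin n) (Polynomial ℂ))
        (U₀ V₀ : Matrix (Fin r) (Fin r) ℂ),
      IsUnimodular U ∧ IsUnimodular V ∧ IsUnit U₀.det ∧ IsUnit V₀.det ∧
      Matrix.fromBlocks U 0 0 (constPoly U₀) * D.egfpG coef C B A E *
          Matrix.fromBlocks V 0 0 (constPoly V₀) =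
        systemMatrix (diagLast m (matPoly m coef)) (blockCol m m C) (blockRow m m B) A E := by
  obtain ⟨s₁, s₂, hs⟩ := List.append_of_mem hσ
  set Φ := compRingEquiv (Fin m) (Fin n) (Polynomial ℂ)
  set F : Matrix (Fin n) (Fin n) ℂ →+* Matrix (Fin n) (Fin n) (Polynomial ℂ) :=
    Polynomial.C.mapMatrix
  obtain ⟨U, V, hU, hV, hUV, hl, hr⟩ := exists_units_gfp (Polynomial.X : Polynomial ℂ)
    (fun j => F (coef j)) (hs ▸ D.perm) hτ
  rw [← hs] at hUV
  obtain ⟨L, hL, hLl, -⟩ := exists_isUnit_inverse (D.isUnit_leftFactor F hσ hτ)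
  obtain ⟨W, hW, -, hWr⟩ := exists_isUnit_inverse (D.isUnit_rightFactor F hσ hτ)
  have hLc := D.leftFactor_mulVec F hτ hs (fun j => F (coef j))
  have hWc := D.vecMul_rightFactor F hτ hs (fun j => F (coef j))
  have hP : matPoly m coef =
      ∑ j ∈ Finset.range (m + 1), (Polynomial.X : Polynomial ℂ) ^ j • F (coef j) := rfl
  have hone : constPoly (1 : Matrix (Fin r) (Fin r) ℂ) = 1 := map_one Polynomial.C.mapMatrix
  -- `L` and `W` cancel the outer factors of the pencil; `U` and `V` reduce what remains. The state
  -- block is left alone.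
  refine ⟨Φ (U * L), Φ (W * V), 1, 1, isUnimodular_of_isUnit ((hU.mul hL).map Φ),
    isUnimodular_of_isUnit ((hW.mul hV).map Φ), by simp, by simp, ?_⟩
  have h11 : Φ (U * L) * D.egfp coef * Φ (W * V) = diagLast m (matPoly m coef) := by
    rw [D.egfp_eq coef hσ hτ, ← comp_dLast, hP, ← hUV, ← map_mul, ← map_mul]
    exact congrArg Φ (mul_cancel_factors hLl hWr U _ V)
  -- `L` takes the border vector back to `M^P_{s₁} e_m`, which `U` sends to `e_m`.
  have hl' : (U * L).mulVec (col _ m (climb 0 (D.σ₁ ++ s₁).reverse)) = col _ m 0 := by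
    rw [← hLc, mulVec_mulVec, mul_assoc, ← mul_assoc L, hLl, one_mul, hl]
  have hr' : vecMul (col _ m (climb 0 (s₂ ++ D.σ₂))) (W * V) = col _ m 0 := by
    rw [← hWc, vecMul_vecMul, ← mul_assoc, mul_assoc _ _ W, hWr, mul_one, hr]
  have h12 : Φ (U * L) * constPoly (blockCol m ((m : ℤ) - inversions 0 (D.σ₁ ++ D.σ)) C) =
      constPoly (blockCol m m C) := by
    have := blockCol_map (m := m) Polynomial.C 0 C
    rw [Nat.cast_zero, sub_zero] at this
    rw [D.inversions_eq hs, constPoly, constPoly, blockCol_map, this, comp_mul_liftCol, hl']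
  have h21 : constPoly (blockRow m ((m : ℤ) - consecutions 0 (D.σ ++ D.σ₂)) B) * Φ (W * V) =
      constPoly (blockRow m m B) := by
    have := blockRow_map (m := m) Polynomial.C 0 B
    rw [Nat.cast_zero, sub_zero] at this
    rw [D.consecutions_eq hs, constPoly, constPoly, blockRow_map, this, liftRow_mul_comp, hr']
  rw [hone, Data.egfpG, systemMatrix, systemMatrix, fromBlocks_multiply, fromBlocks_multiply]
  simp only [Matrix.zero_mul, Matrix.mul_zero, add_zero, zero_add, Matrix.one_mul, Matrix.mul_one]
  rw [h11, h12, h21]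

theorem toRat_constPoly {α β : Type} (M : Matrix α β ℂ) :
    toRat (constPoly M) = M.map (RatFunc.C : ℂ →+* RatFunc ℂ) := by
  ext i j
  simp [toRat, constPoly]

/-- A minimal realization stays minimal when `C` and `B` are padded by zero blocks, whatever the
polynomial part. -/
theorem isIrreducibleSystem_block {P : Matrix (Fin n) (Fin n) (Polynomial ℂ)}
    (h : IsIrreducibleSystem P C B A E)
    (T : Matrix (Fin m × Fin n) (Fin m × Fin n) (Polynomial ℂ)) {p q : ℕ} (hp : p < m)
    (hq : q < m) :
    IsIrreducibleSystem T (blockCol m ((m : ℤ) - p) C) (blockRow m ((m : ℤ) - q) B) A E := by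
  refine ⟨h.1, fun r' P' C' B' A' E' hE' he => ?_⟩
  -- Block row `m - p` and block column `m - q`: the one block that the padded `C` and `B` reach.
  set i : Fin n → Fin m × Fin n := fun a => (⟨m - 1 - p, by omega⟩, a) with hi
  set j : Fin n → Fin m × Fin n := fun a => (⟨m - 1 - q, by omega⟩, a) with hj
  -- The polynomial part is corrected by `P - T` on that block, so the restricted competitor
  -- realizes the original transfer function with the same `r'`.
  refine h.2 r' (P - T.submatrix i j + P'.submatrix i j) (C'.submatrix i id) (B'.submatrix id j)
    A' E' hE' ?_
  have hC : (blockCol m ((m : ℤ) - p) C).submatrix i id = C := by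
    ext a b
    simp only [blockCol, hi, submatrix_apply, of_apply, id_eq]
    exact if_pos (by omega)
  have hB : (blockRow m ((m : ℤ) - q) B).submatrix id j = B := by
    ext a b
    simp only [blockRow, hj, submatrix_apply, of_apply, id_eq]
    exact if_pos (by omega)
  have key : ∀ (s : ℕ) (Q : Matrix (Fin m × Fin n) (Fin m × Fin n) (Polynomial ℂ))
      (C₁ : Matrix (Fin m × Fin n) (Fin s) ℂ) (B₁ : Matrix (Fin s) (Fin m × Fin n) ℂ)
      (A₁ E₁ : Matrix (Fin s) (Fin s) ℂ),
      (transferFunction Q C₁ B₁ A₁ E₁).submatrix i j =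
        toRat (Q.submatrix i j) + toRat (constPoly (C₁.submatrix i id)) *
          (-toRat (pencil A₁ E₁))⁻¹ * toRat (constPoly (B₁.submatrix id j)) := fun _ _ _ _ _ _ => rfl
  have := congrArg (fun M => M.submatrix i j) he
  simp only [key, hC, hB] at this
  have hadd : ∀ M N : Matrix (Fin n) (Fin n) (Polynomial ℂ), toRat (M + N) = toRat M + toRat N :=
    fun M N => map_add (algebraMap (Polynomial ℂ) (RatFunc ℂ)).mapMatrix M N
  have hsub : ∀ M N : Matrix (Fin n) (Fin n) (Polynomial ℂ), toRat (M - N) = toRat M - toRat N :=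
    fun M N => map_sub (algebraMap (Polynomial ℂ) (RatFunc ℂ)).mapMatrix M N
  rw [transferFunction, transferFunction, hadd, hsub, add_assoc, this]
  abel

/-- The proper part `C (λ E - A)⁻¹ B` of a realization, over the ring of proper functions. -/
theorem exists_proper_part (hE : IsUnit E.det) :
    ∃ g : Matrix (Fin n) (Fin n) properRing, properRing.subtype.mapMatrix g =
      C.map (RatFunc.C : ℂ →+* RatFunc ℂ) * (-toRat (pencil A E))⁻¹ *
        B.map (RatFunc.C : ℂ →+* RatFunc ℂ) := by
  -- `λE - A = λM` with `M = E - λ⁻¹A`. The value of `M` at infinity is `E`, so `M` is invertible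
  -- over the proper ring.
  set M : Matrix (Fin r) (Fin r) properRing :=
    properC.mapMatrix E - properXInv • properC.mapMatrix A with hM
  have hv : ∀ c : ℂ, valueAtInfty (properC c) = c := fun c =>
    valueAtInfty_eq (hasLimitAtInfty_C c)
  have hx : valueAtInfty properXInv = 0 := valueAtInfty_eq hasLimitAtInfty_X_inv
  have hMv : valueAtInfty.mapMatrix M = E := by
    ext a b
    simp [hM, hv, hx]
  have hMu : IsUnit M.det := by
    refine isUnit_of_valueAtInfty_ne_zero ?_
    rw [RingHom.map_det, hMv]
    exact hE.ne_zero
  have hι : ∀ c : ℂ, properRing.subtype (properC c) = RatFunc.C c := fun _ => rfl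
  have hιx : properRing.subtype properXInv = (RatFunc.X : RatFunc ℂ)⁻¹ := rfl
  have hpen : -toRat (pencil A E) =
      (RatFunc.X : RatFunc ℂ) • properRing.subtype.mapMatrix M := by
    ext a b
    simp only [hM, pencil, toRat, constPoly, Matrix.neg_apply, map_apply, Matrix.sub_apply,
      Matrix.smul_apply, smul_eq_mul, map_sub, map_mul, RingHom.mapMatrix_apply, hι, hιx,
      RatFunc.algebraMap_X, RatFunc.algebraMap_C]
    have : (RatFunc.X : RatFunc ℂ) ≠ 0 := RatFunc.X_ne_zero
    field_simp
    ring
  have hinv : (-toRat (pencil A E))⁻¹ =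
      (RatFunc.X : RatFunc ℂ)⁻¹ • properRing.subtype.mapMatrix M⁻¹ := by
    refine Matrix.inv_eq_right_inv ?_
    rw [hpen, smul_mul_smul_comm, mul_inv_cancel₀ RatFunc.X_ne_zero, one_smul, ← map_mul,
      Matrix.mul_nonsing_inv _ hMu, map_one]
  refine ⟨C.map properC * (properXInv • M⁻¹) * B.map properC, ?_⟩
  have hmid : (properXInv • M⁻¹).map properRing.subtype =
      (RatFunc.X : RatFunc ℂ)⁻¹ • properRing.subtype.mapMatrix M⁻¹ := by
    ext a b
    simp only [map_apply, Matrix.smul_apply, smul_eq_mul, map_mul, hιx, RingHom.mapMatrix_apply]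
  rw [hinv, RingHom.mapMatrix_apply, Matrix.map_mul, Matrix.map_mul, hmid]
  rfl

end Linearization

/-! ### Biproper equivalence at infinity -/

section Infinity

variable {m n r : ℕ} (D : Data m n) (coef : ℕ → Matrix (Fin n) (Fin n) ℂ)
variable (C : Matrix (Fin n) (Fin r) ℂ) (B : Matrix (Fin r) (Fin n) ℂ)
  (A E : Matrix (Fin r) (Fin r) ℂ)

/-- Replacing `A_0` by `A_0 + g` changes `M^P_σ` by a matrix of rank one over the block ring. -/
theorem fPos_add_proper {S : Type*} [Ring S] (a : ℕ → S) (g : S) {s₁ s₂ : List ℕ}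
    (h₁ : 0 ∉ s₁) (h₂ : 0 ∉ s₂) :
    fPos m (fun j => a j + if j = 0 then g else 0) (s₁ ++ 0 :: s₂) =
      fPos m a (s₁ ++ 0 :: s₂) -
        outer ((fPos m a s₁).mulVec (col S m 0)) g (vecMul (col S m 0) (fPos m a s₂)) := by
  have e : ∀ s : List ℕ, 0 ∉ s → fPos m (fun j => a j + if j = 0 then g else 0) s = fPos m a s :=
    fun s hs => fPos_congr fun i hi => by rw [if_neg fun h : i = 0 => hs (h ▸ hi), add_zero]
  rw [fPos_append, fPos_append, fPos_cons, fPos_cons, e _ h₁, e _ h₂, if_pos rfl, ePos_zero,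
    ePos_zero, neg_add', dLast_sub, sub_mul, mul_sub, ← mul_assoc (fPos m a s₁) (outer _ _ _),
    mul_outer_mul]

/-- The transfer function of the bordered pencil is, up to the factor `λ`, the pencil of the
coefficients with `A_0` replaced by `A_0 + C (λ E - A)⁻¹ B`. -/
theorem Data.transferFunction_eq (hσ : 0 ∈ D.σ) (hτ : m ∈ D.ω)
    {g : Matrix (Fin n) (Fin n) properRing}
    (hg : properRing.subtype.mapMatrix g =
      C.map (RatFunc.C : ℂ →+* RatFunc ℂ) * (-toRat (pencil A E))⁻¹ *
        B.map (RatFunc.C : ℂ →+* RatFunc ℂ)) :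
    (RatFunc.X : RatFunc ℂ)⁻¹ • transferFunction (D.egfp coef)
      (blockCol m ((m : ℤ) - inversions 0 (D.σ₁ ++ D.σ)) C)
      (blockRow m ((m : ℤ) - consecutions 0 (D.σ ++ D.σ₂)) B) A E =
    properRing.subtype.mapMatrix (compRingEquiv (Fin m) (Fin n) properRing
      (D.leftFactor properC.mapMatrix *
        (fNeg m (fun j => properC.mapMatrix (coef j) + if j = 0 then g else 0) D.ω -
          properXInv •
            fPos m (fun j => properC.mapMatrix (coef j) + if j = 0 then g else 0) D.σ) *
        D.rightFactor properC.mapMatrix)) := by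
  obtain ⟨s₁, s₂, hs⟩ := List.append_of_mem hσ
  have hnd := (List.nodup_append.1 D.nodup).1
  rw [hs] at hnd
  have h₁ : 0 ∉ s₁ := fun h => (List.nodup_append.1 hnd).2.2 0 h 0 (by simp) rfl
  have h₂ : 0 ∉ s₂ := (List.nodup_cons.1 (List.nodup_append.1 hnd).2.1).1
  set K := RatFunc ℂ
  set F : Matrix (Fin n) (Fin n) ℂ →+* Matrix (Fin n) (Fin n) K :=
    (RatFunc.C : ℂ →+* RatFunc ℂ).mapMatrix with hF
  set G := C.map (RatFunc.C : ℂ →+* RatFunc ℂ) * (-toRat (pencil A E))⁻¹ *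
        B.map (RatFunc.C : ℂ →+* RatFunc ℂ) with hG
  have c1 : properRing.subtype.mapMatrix.comp properC.mapMatrix = F := rfl
  have c2 : (algebraMap (Polynomial ℂ) (RatFunc ℂ)).mapMatrix.comp Polynomial.C.mapMatrix = F := by
    ext M i j
    simp [hF]
  have c1' : ∀ M, properRing.subtype.mapMatrix (properC.mapMatrix M) = F M := fun _ => rfl
  have c2' : ∀ M : Matrix (Fin n) (Fin n) ℂ, (algebraMap (Polynomial ℂ) (RatFunc ℂ)).mapMatrix
      (Polynomial.C.mapMatrix M) = F M := fun M => by rw [← c2]; rfl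
  have c3 : ∀ j : ℕ, properRing.subtype.mapMatrix (if j = 0 then g else 0) =
      if j = 0 then G else 0 := fun j => by
    split_ifs
    · exact hg
    · exact map_zero _
  -- Since `0 ∉ ω`, changing `A_0` affects only `M^P_σ`.
  have hω : fNeg m (fun j => F (coef j) + if j = 0 then G else 0) D.ω =
      fNeg m (fun j => F (coef j)) D.ω := fNeg_congr fun i hi => by
    rw [if_neg fun h : i = 0 => D.not_mem_ω hσ (h ▸ hi), add_zero]
  have hT : toRat (D.egfp coef) = compRingEquiv (Fin m) (Fin n) K (D.leftFactor F *
      ((RatFunc.X : K) • fNeg m (fun j => F (coef j)) D.ω - fPos m (fun j => F (coef j)) D.σ) *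
        D.rightFactor F) := by
    rw [D.egfp_eq coef hσ hτ]
    refine (comp_mapMatrix (algebraMap (Polynomial ℂ) (RatFunc ℂ)) _).symm.trans (congrArg _ ?_)
    rw [map_mul, map_mul, mapMatrix_leftFactor, mapMatrix_rightFactor, map_sub,
      mapMatrix_mapMatrix_smul, mapMatrix_fNeg, mapMatrix_fPos, RatFunc.algebraMap_X, c2]
    simp only [c2']
  have hR : properRing.subtype.mapMatrix.mapMatrix (D.leftFactor properC.mapMatrix *
        (fNeg m (fun j => properC.mapMatrix (coef j) + if j = 0 then g else 0) D.ω -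
          properXInv •
            fPos m (fun j => properC.mapMatrix (coef j) + if j = 0 then g else 0) D.σ) *
        D.rightFactor properC.mapMatrix) =
      D.leftFactor F * (fNeg m (fun j => F (coef j)) D.ω - (RatFunc.X : K)⁻¹ •
        (fPos m (fun j => F (coef j)) D.σ - outer
          ((fPos m (fun j => F (coef j)) s₁).mulVec (col _ m 0)) G
            (vecMul (col _ m 0) (fPos m (fun j => F (coef j)) s₂)))) * D.rightFactor F := by
    rw [map_mul, map_mul, mapMatrix_leftFactor, mapMatrix_rightFactor, map_sub,
      mapMatrix_mapMatrix_smul, mapMatrix_fNeg, mapMatrix_fPos, c1]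
    simp only [map_add, c1', c3]
    rw [hω, hs, fPos_add_proper _ _ h₁ h₂]
    rfl
  rw [← comp_mapMatrix, hR]
  -- The border vectors are rewritten as images of `e_m` under the outer factors, so the coupling
  -- term takes the form of the correction in `hR`.
  rw [transferFunction, hT, toRat_constPoly, toRat_constPoly, D.inversions_eq hs,
    D.consecutions_eq hs, blockCol_map, blockRow_map, liftCol_mul_mul_liftRow, ← hG, ← map_add,
    ← comp_smul, ← D.leftFactor_mulVec F hτ hs (fun j => F (coef j)),
    ← D.vecMul_rightFactor F hτ hs (fun j => F (coef j)), ← mulVec_mulVec, ← vecMul_vecMul,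
    ← mul_outer_mul]
  refine congrArg _ ?_
  have hx : (RatFunc.X : K)⁻¹ * RatFunc.X = 1 := inv_mul_cancel₀ RatFunc.X_ne_zero
  simp only [smul_add, mul_sub, sub_mul, smul_sub, smul_mul_assoc, mul_smul_comm, smul_smul, hx,
    one_smul]
  abel

/-- The biproper equivalence at infinity. -/
theorem Data.exists_biproper (hE : IsUnit E.det) (hσ : 0 ∈ D.σ) (hτ : m ∈ D.ω) :
    ∃ Oₗ Oᵣ : Matrix (Fin m × Fin n) (Fin m × Fin n) (RatFunc ℂ),
      IsBiproper Oₗ ∧ IsBiproper Oᵣ ∧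
      Oₗ * ((RatFunc.X : RatFunc ℂ)⁻¹ • transferFunction (D.egfp coef)
        (blockCol m ((m : ℤ) - inversions 0 (D.σ₁ ++ D.σ)) C)
        (blockRow m ((m : ℤ) - consecutions 0 (D.σ ++ D.σ₂)) B) A E) * Oᵣ =
        diagLast m
          (((RatFunc.X : RatFunc ℂ) ^ m)⁻¹ • transferFunction (matPoly m coef) C B A E) := by
  obtain ⟨g, hg⟩ := exists_proper_part C B A E hE
  rw [D.transferFunction_eq coef C B A E hσ hτ hg]
  set a : ℕ → Matrix (Fin n) (Fin n) properRing :=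
    fun j => properC.mapMatrix (coef j) + if j = 0 then g else 0 with ha
  obtain ⟨U, V, hU, hV, hUV⟩ := exists_units_gfp_reversal properXInv a D.perm hσ hτ
  obtain ⟨L, hL, hLl, -⟩ := exists_isUnit_inverse (D.isUnit_leftFactor properC.mapMatrix hσ hτ)
  obtain ⟨W, hW, -, hWr⟩ := exists_isUnit_inverse (D.isUnit_rightFactor properC.mapMatrix hσ hτ)
  refine ⟨_, _, isBiproper_of_isUnit ((hU.mul hL).map (compRingEquiv (Fin m) (Fin n) properRing)),
    isBiproper_of_isUnit ((hW.mul hV).map (compRingEquiv (Fin m) (Fin n) properRing)), ?_⟩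
  rw [← map_mul, ← map_mul, ← map_mul, ← map_mul, mul_cancel_factors hLl hWr, hUV,
    ← comp_mapMatrix, ← comp_dLast]
  refine congrArg _ ?_
  have hd : ∀ Q : Matrix (Fin n) (Fin n) properRing,
      properRing.subtype.mapMatrix.mapMatrix (dLast m Q) =
        dLast m (properRing.subtype.mapMatrix Q) := fun Q => by
    rw [← ePos_zero, mapMatrix_ePos, ePos_zero]
  rw [hd]
  refine congrArg _ ?_
  -- Reindexed, the reversed sum is `∑ λ^{j-m} a_j = λ^{-m} ∑ λ^j a_j`.
  have hsum : ∑ j ∈ Finset.range (m + 1), properXInv ^ j • a (m - j) =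
      ∑ j ∈ Finset.range (m + 1), properXInv ^ (m - j) • a j := by
    rw [← Finset.sum_flip]
    refine Finset.sum_congr rfl fun j hj => ?_
    rw [Finset.mem_range] at hj
    rw [show m - (m - j) = j by omega]
  have hsm : ∀ (t : properRing) (Q : Matrix (Fin n) (Fin n) properRing),
      properRing.subtype.mapMatrix (t • Q) =
        properRing.subtype t • properRing.subtype.mapMatrix Q := fun t Q =>
    Matrix.ext fun i j => map_mul properRing.subtype t (Q i j)
  have hx : (RatFunc.X : RatFunc ℂ) ≠ 0 := RatFunc.X_ne_zero
  have hpow : ∀ j ∈ Finset.range (m + 1), properRing.subtype (properXInv ^ (m - j)) =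
      ((RatFunc.X : RatFunc ℂ) ^ m)⁻¹ * (RatFunc.X : RatFunc ℂ) ^ j := fun j hj => by
    rw [Finset.mem_range] at hj
    rw [map_pow, show properRing.subtype properXInv = (RatFunc.X : RatFunc ℂ)⁻¹ from rfl, inv_pow,
      pow_sub₀ _ hx (by omega), mul_inv, inv_inv]
  have hP : toRat (matPoly m coef) = ∑ j ∈ Finset.range (m + 1),
      (RatFunc.X : RatFunc ℂ) ^ j • (RatFunc.C : ℂ →+* RatFunc ℂ).mapMatrix (coef j) := by
    ext p q
    simp [toRat, matPoly, constPoly, Matrix.sum_apply]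
    exact Finset.sum_congr rfl fun _ _ => mul_comm _ _
  rw [transferFunction, toRat_constPoly, toRat_constPoly, ← hg, hP, hsum, map_sum, smul_add,
    Finset.smul_sum]
  simp only [hsm, ha, map_add, smul_add, Finset.sum_add_distrib]
  congr 1
  · refine Finset.sum_congr rfl fun j hj => ?_
    rw [hpow j hj, smul_smul]
    rfl
  -- The summand `g` sits only in the coefficient of index `0`, where the factor is `λ^{-m}`.
  · rw [Finset.sum_eq_single 0]
    · rw [hpow 0 (by simp), if_pos rfl, pow_zero, mul_one]
    · intro j _ hj
      rw [if_neg hj, map_zero, smul_zero]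
    · simp

end Infinity

end EGFP

theorem mainTheorem4 (m n r : ℕ) (hm : 2 ≤ m)
    (coef : ℕ → Matrix (Fin n) (Fin n) ℂ) (hcoef : coef m ≠ 0)
    (C : Matrix (Fin n) (Fin r) ℂ) (B : Matrix (Fin r) (Fin n) ℂ)
    (A E : Matrix (Fin r) (Fin r) ℂ)
    (hS : EGFP.IsIrreducibleSystem (EGFP.matPoly m coef) C B A E)
    (D : EGFP.Data m n) (hσ : 0 ∈ D.σ) (hτ : m ∈ D.ω) :
    EGFP.IsRosenbrockStrongLinearization m (D.egfpG coef C B A E)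
      (EGFP.matPoly m coef) C B A E := by
  obtain ⟨s₁, s₂, hs⟩ := List.append_of_mem hσ
  refine ⟨D.constCoeff coef, D.negLeadingCoeff coef,
    EGFP.blockCol m ((m : ℤ) - EGFP.inversions 0 (D.σ₁ ++ D.σ)) C,
    EGFP.blockRow m ((m : ℤ) - EGFP.consecutions 0 (D.σ ++ D.σ₂)) B, A, E, ?_, ?_,
    D.exists_unimodular coef C B A E hσ hτ, ?_⟩
  · rw [D.pencil_eq_egfp coef]
    rfl
  · rw [D.inversions_eq hs, D.consecutions_eq hs]
    -- Both climbs end at indices of `σ`, which are below `m`, so the borders sit in genuine block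
    -- positions.
    exact EGFP.isIrreducibleSystem_block C B A E hS _ (D.σ_lt hτ (D.climb_left_mem hs))
      (D.σ_lt hτ (D.climb_right_mem hs))
  · rw [D.pencil_eq_egfp coef]
    exact D.exists_biproper coef C B A E hS.1 hσ hτ
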